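/- Let $k$ be a field of characteristic $p>0$ and let $G$ be a finite group scheme over $k$, with group algebra $kG$ (the linear dual of the coordinate algebra $k[G]$); for a field extension $K/k$ put $KG=K\otimes_k kG$ and $V_K=K\otimes_k V$. All modules are finitely generated. For $s\in\mathbb Z$ let $\Omega^s(k)$ be the $s$-th Heller shift of the trivial module $k$, defined by iterating kernels of projective covers ($s>0$) or cokernels of injective hulls ($s<0$). The Tate cohomology group $\widehat{\mathrm H}^{a-b}(G,k)$ is identified with the group of morphisms $\Omega^{a}(k)\to\Omega^{b}(k)$ in the stable module category (homomorphisms modulo those that factor through a projective module), products being given by composition; the same applies to $K[t]/t^p$ in place of $kG$. A $\pi$-point of $G$ is a left flat homomorphism of $K$-algebras $\alpha_K\colon K[t]/t^p\to KG$, for a field extension $K/k$, that factors through the group algebra of some unipotent abelian subgroup scheme of $G_K$; $\alpha_K^*$ denotes restriction along $\alpha_K$ (after base change to $K$). Write $[i]$ for the Jordan block $K[t]/t^i$, $1\le i\le p$. Let $m>n\ge 0$ be integers, and let $m_1,\dots,m_m$ and $n_1,\dots,n_n$ be integers, all of them even if $p>2$. Choose cohomology classes $\zeta_{i,j}\in\widehat{\mathrm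 H}^{m_j-n_i}(G,k)$ and homomorphisms $\hat\zeta_{i,j}\colon\Omega^{m_j}(k)\to\Omega^{n_i}(k)$ representing them ($1\le i\le n$, $1\le j\le m$). Let $$0\to L\to M\xrightarrow{\ \varphi\ }N\to 0$$ be an exact sequence of $kG$-modules, where $$M\cong\bigoplus_{j=1}^m\Omega^{m_j}(k)\oplus P,\qquad N\cong\bigoplus_{i=1}^n\Omega^{n_i}(k),$$ $P$ is projective, and $\varphi$ is given on $\bigoplus_j\Omega^{m_j}(k)$ by the matrix $(\hat\zeta_{i,j})$ (and is arbitrary on $P$). Assume that for every $\pi$-point $\alpha_K$ the restricted matrix $(\alpha_K^*(\zeta_{i,j}))$, with entries in $\widehat{\mathrm H}^{*}(K[t]/t^p,K)$, has rank $n$, i.e. its $n$ rows are linearly independent over the graded ring $\widehat{\mathrm H}^{*}(K[t]/t^p,K)$. Then $L$ has stable constant Jordan type $(m-n)[1]$: there is an integer $r\ge 0$ such that for every $\pi$-point $\alpha_K$ the $K[t]/t^p$-module $\alpha_K^*(L_K)$ is isomorphic to $r[p]+(m-n)[1]$. -/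

import Mathlib

open scoped TensorProduct Polynomial

universe u

namespace FinGroupScheme

noncomputable section

/-! ## Finite group schemes and their group algebras

A finite group scheme `G` over a field `k` is given by its coordinate algebra `k[G]`, a
finite-dimensional commutative Hopf algebra `R` over `k`. -/

/-- The group algebra `kG`: the linear dual of the coordinate algebra `R = k[G]`, with the
convolution product dual to the comultiplication of `R`. -/
abbrev GroupAlgebra (k R : Type u) [Field k] [CommRing R] [HopfAlgebra k R] : Type u :=
  WithConv (R →ₗ[k] k)

/-- The augmentation `kG → k`, evaluation of a functional at `1 ∈ k[G]`. -/
def augmentation (k R : Type u) [Field k] [CommRing R] [HopfAlgebra k R] :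
    GroupAlgebra k R →+* k where
  toFun f := f 1
  map_one' := by simp
  map_mul' f g := by
    simp [LinearMap.convMul_apply, Bialgebra.comul_one, Algebra.TensorProduct.one_def]
  map_zero' := rfl
  map_add' _ _ := rfl

theorem augmentation_apply (k R : Type u) [Field k] [CommRing R] [HopfAlgebra k R]
    (f : GroupAlgebra k R) : augmentation k R f = f 1 := rfl

/-- The trivial `kG`-module `k`. -/
def Trivial (k R : Type u) [Field k] [CommRing R] [HopfAlgebra k R] : Type u := k

instance (k R : Type u) [Field k] [CommRing R] [HopfAlgebra k R] :
    AddCommGroup (Trivial k R) :=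
  inferInstanceAs (AddCommGroup k)

instance (k R : Type u) [Field k] [CommRing R] [HopfAlgebra k R] :
    Module (GroupAlgebra k R) (Trivial k R) :=
  Module.compHom k (augmentation k R)

/-- The finite group scheme with coordinate algebra `S` is unipotent: every nonzero
representation has a nonzero fixed vector, i.e. a nonzero vector on which the group algebra acts
through the augmentation. -/
def IsUnipotent (k S : Type u) [Field k] [CommRing S] [HopfAlgebra k S] : Prop :=
  ∀ (V : Type u) [AddCommGroup V] [Module (GroupAlgebra k S) V] [Nontrivial V],
    ∃ v : V, v ≠ 0 ∧ ∀ f : GroupAlgebra k S,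
      f • v = algebraMap k (GroupAlgebra k S) (augmentation k S f) • v

/-! ## π-points and restriction along them -/

/-- The algebra `K[t]/t^p`. -/
abbrev Trunc (K : Type u) [Field K] (p : ℕ) : Type u :=
  K[X] ⧸ Ideal.span {(Polynomial.X : K[X]) ^ p}

/-- The class of `t` in `K[t]/t^p`. -/
def Trunc.t (K : Type u) [Field K] (p : ℕ) : Trunc K p :=
  Ideal.Quotient.mk _ Polynomial.X

section PiPoint

variable {k R : Type u} [Field k] [CommRing R] [HopfAlgebra k R]
  {K : Type u} [Field K] [Algebra k K] {p : ℕ}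

/-- The canonical map from `KG = K ⊗ kG` to the dual of the coordinate algebra `K[G_K] = K ⊗ k[G]`
of `G_K`; it is bijective when `k[G]` is finite-dimensional. -/
def toDual (k R K : Type u) [Field k] [CommRing R] [HopfAlgebra k R] [Field K] [Algebra k K] :
    K ⊗[k] GroupAlgebra k R →ₗ[K] Module.Dual K (K ⊗[k] R) :=
  LinearMap.liftBaseChange K
    (Module.Dual.baseChange K ∘ₗ (WithConv.linearEquiv k (R →ₗ[k] k)).toLinearMap)

/-- `α : K[t]/t^p → KG` is a π-point of `G`: it is left flat, and it factors through the group
algebra `KC ⊂ KG` of some unipotent abelian closed subgroup scheme `C ⊂ G_K`.  Closed subgroup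
schemes of `G_K` are the Hopf ideals `I` of `K[G_K] = K ⊗ k[G]`, with `K[C] = K[G_K] / I`, so that
`KC` consists of the functionals on `K[G_K]` that vanish on `I`; and `C` is abelian when `K[C]` is
cocommutative. -/
structure IsPiPoint (α : Trunc K p →ₐ[K] K ⊗[k] GroupAlgebra k R) : Prop where
  flat : @Module.Flat (Trunc K p) (K ⊗[k] GroupAlgebra k R) _ _
    (Module.compHom _ α.toRingHom)
  factors : ∃ (I : Ideal (K ⊗[k] R)) (_ : I.IsHopfIdeal K),
    Coalgebra.IsCocomm K ((K ⊗[k] R) ⧸ I) ∧ IsUnipotent K ((K ⊗[k] R) ⧸ I) ∧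
      ∀ x : Trunc K p, ∀ h ∈ I, toDual k R K (α x) h = 0

/-- The action of `KG` on `V_K = K ⊗ V`, for a `kG`-module `V`. -/
def baseChangeAction (k R K V : Type u) [Field k] [CommRing R] [HopfAlgebra k R]
    [Field K] [Algebra k K] [AddCommGroup V] [Module k V] [Module (GroupAlgebra k R) V]
    [IsScalarTower k (GroupAlgebra k R) V] :
    K ⊗[k] GroupAlgebra k R →ₐ[K] Module.End K (K ⊗[k] V) :=
  Algebra.TensorProduct.lift (Algebra.ofId K (Module.End K (K ⊗[k] V)))
    ((Module.End.baseChangeHom k K V).comp (Algebra.lsmul k k V))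
    (by intro c g; rw [Algebra.ofId_apply]; exact Algebra.commute_algebraMap_left c _)

theorem baseChangeAction_tmul (V : Type u) [AddCommGroup V] [Module k V]
    [Module (GroupAlgebra k R) V] [IsScalarTower k (GroupAlgebra k R) V]
    (c d : K) (g : GroupAlgebra k R) (v : V) :
    baseChangeAction k R K V (c ⊗ₜ[k] g) (d ⊗ₜ[k] v) = (c * d) ⊗ₜ[k] (g • v) := by
  rw [baseChangeAction, Algebra.TensorProduct.lift_tmul, Module.End.mul_apply]
  change c • (LinearMap.baseChange K (Algebra.lsmul k k V g) (d ⊗ₜ[k] v)) = _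
  rw [LinearMap.baseChange_tmul, TensorProduct.smul_tmul', smul_eq_mul, Algebra.lsmul_coe]

/-- The `K[t]/t^p`-module `α^*(V_K)`, with underlying `K`-vector space `V_K = K ⊗ V`. -/
def Restrict (_α : Trunc K p →ₐ[K] K ⊗[k] GroupAlgebra k R) (V : Type u)
    [AddCommGroup V] [Module k V] : Type u :=
  K ⊗[k] V

variable (α : Trunc K p →ₐ[K] K ⊗[k] GroupAlgebra k R)

section
variable (V : Type u) [AddCommGroup V] [Module k V]

instance : AddCommGroup (Restrict α V) := inferInstanceAs (AddCommGroup (K ⊗[k] V))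

variable [Module (GroupAlgebra k R) V] [IsScalarTower k (GroupAlgebra k R) V]

instance : Module (Trunc K p) (Restrict α V) :=
  @Module.compHom (Module.End K (K ⊗[k] V)) (Trunc K p) (K ⊗[k] V) _ _ _ _
    ((baseChangeAction k R K V).comp α).toRingHom

end

variable {V W : Type u} [AddCommGroup V] [Module k V] [Module (GroupAlgebra k R) V]
  [IsScalarTower k (GroupAlgebra k R) V]
  [AddCommGroup W] [Module k W] [Module (GroupAlgebra k R) W]
  [IsScalarTower k (GroupAlgebra k R) W]

theorem baseChange_action_comm (f : V →ₗ[GroupAlgebra k R] W) (x : K ⊗[k] GroupAlgebra k R)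
    (v : K ⊗[k] V) :
    (f.restrictScalars k).baseChange K (baseChangeAction k R K V x v) =
      baseChangeAction k R K W x ((f.restrictScalars k).baseChange K v) := by
  induction x with
  | zero => simp
  | add x y hx hy => simp [hx, hy]
  | tmul c g =>
    induction v with
    | zero => simp
    | add x y hx hy => simp only [map_add, hx, hy]
    | tmul d v => simp [baseChangeAction_tmul]

/-- The `K[t]/t^p`-linear map `α^*(f_K) : α^*(V_K) → α^*(W_K)` induced by a `kG`-linear map
`f : V → W`. -/
def restrictHom (f : V →ₗ[GroupAlgebra k R] W) : Restrict α V →ₗ[Trunc K p] Restrict α W where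
  toFun := (f.restrictScalars k).baseChange K
  map_add' := map_add _
  map_smul' x v := baseChange_action_comm f (α x) v

end PiPoint

/-! ## Jordan types -/

/-- The indecomposable `K[t]/t^p`-module `[i] = K[t]/t^i` (for `1 ≤ i ≤ p`), a Jordan block of
size `i`. -/
abbrev JordanBlock (K : Type u) [Field K] (p i : ℕ) : Type u :=
  Trunc K p ⧸ Ideal.span {Trunc.t K p ^ i}

/-- The `K[t]/t^p`-module `W` has Jordan type `a_p[p] + ⋯ + a_1[1]`. -/
def HasJordanType (K : Type u) [Field K] (p : ℕ) (a : ℕ → ℕ) (W : Type u) [AddCommGroup W]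
    [Module (Trunc K p) W] : Prop :=
  Nonempty (W ≃ₗ[Trunc K p] ((i : Finset.Icc 1 p) → Fin (a i) → JordanBlock K p i))

/-- The `kG`-module `V` has constant Jordan type `a_p[p] + ⋯ + a_1[1]`: it is finite-dimensional
and `α^*(V_K)` has this Jordan type for every field extension `K/k` and every π-point `α`. -/
def HasConstantJordanType (k R : Type u) [Field k] [CommRing R] [HopfAlgebra k R] (p : ℕ)
    (a : ℕ → ℕ) (V : Type u) [AddCommGroup V] [Module k V] [Module (GroupAlgebra k R) V]
    [IsScalarTower k (GroupAlgebra k R) V] : Prop :=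
  Module.Finite k V ∧
    ∀ (K : Type u) [Field K] [Algebra k K] (α : Trunc K p →ₐ[K] K ⊗[k] GroupAlgebra k R),
      IsPiPoint α → HasJordanType K p a (Restrict α V)

/-- The `kG`-module `V` has stable constant Jordan type `b_{p-1}[p-1] + ⋯ + b_1[1]`: it has
constant Jordan type, and the number of blocks of size `i` is `b_i` for all `1 ≤ i < p`. -/
def HasStableConstantJordanType (k R : Type u) [Field k] [CommRing R] [HopfAlgebra k R] (p : ℕ)
    (b : ℕ → ℕ) (V : Type u) [AddCommGroup V] [Module k V] [Module (GroupAlgebra k R) V]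
    [IsScalarTower k (GroupAlgebra k R) V] : Prop :=
  ∃ a : ℕ → ℕ, (∀ i, 1 ≤ i → i < p → a i = b i) ∧ HasConstantJordanType k R p a V

/-! ## Heller shifts -/

section Heller

variable (A : Type u) [Ring A]

/-- `V` is isomorphic to `Ω(W)`, the kernel of a projective cover `f : P → W`: `P` is finitely
generated projective, and `f` is surjective with superfluous kernel. -/
def IsSyzygy (W V : Type u) [AddCommGroup W] [Module A W] [AddCommGroup V] [Module A V] : Prop :=
  ∃ (P : Type u) (_ : AddCommGroup P) (_ : Module A P) (f : P →ₗ[A] W),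
    Module.Finite A P ∧ Module.Projective A P ∧ Function.Surjective f ∧
    (∀ U : Submodule A P, U ⊔ LinearMap.ker f = ⊤ → U = ⊤) ∧
    Nonempty (V ≃ₗ[A] LinearMap.ker f)

/-- `V` is isomorphic to `Ω⁻¹(W)`, the cokernel of an injective hull `f : W → I`: `I` is finitely
generated injective, and `f` is injective with essential image. -/
def IsCosyzygy (W V : Type u) [AddCommGroup W] [Module A W] [AddCommGroup V] [Module A V] :
    Prop :=
  ∃ (I : Type u) (_ : AddCommGroup I) (_ : Module A I) (f : W →ₗ[A] I),
    Module.Finite A I ∧ Module.Injective A I ∧ Function.Injective f ∧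
    (∀ U : Submodule A I, U ⊓ LinearMap.range f = ⊥ → U = ⊥) ∧
    Nonempty (V ≃ₗ[A] I ⧸ LinearMap.range f)

/-- `V` is isomorphic to `Ω^n(W)`, `n : ℕ`. -/
def IsIterSyzygy (W : Type u) [AddCommGroup W] [Module A W] :
    ℕ → ∀ (V : Type u) [AddCommGroup V] [Module A V], Prop
  | 0, V, _, _ => Nonempty (V ≃ₗ[A] W)
  | n + 1, V, _, _ => ∃ (U : Type u) (_ : AddCommGroup U) (_ : Module A U),
      IsIterSyzygy W n U ∧ IsSyzygy A U V

/-- `V` is isomorphic to `Ω^{-n}(W)`, `n : ℕ`. -/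
def IsIterCosyzygy (W : Type u) [AddCommGroup W] [Module A W] :
    ℕ → ∀ (V : Type u) [AddCommGroup V] [Module A V], Prop
  | 0, V, _, _ => Nonempty (V ≃ₗ[A] W)
  | n + 1, V, _, _ => ∃ (U : Type u) (_ : AddCommGroup U) (_ : Module A U),
      IsIterCosyzygy W n U ∧ IsCosyzygy A U V

/-- `V` is isomorphic to the `s`-th Heller shift `Ω^s(W)`, `s : ℤ`. -/
def IsHellerShift (W : Type u) [AddCommGroup W] [Module A W] :
    ℤ → ∀ (V : Type u) [AddCommGroup V] [Module A V], Prop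
  | .ofNat n, V, _, _ => IsIterSyzygy A W n V
  | .negSucc n, V, _, _ => IsIterCosyzygy A W (n + 1) V

end Heller

/-! ## Stable homomorphisms and Tate cohomology classes

For `A = kG` or `A = K[t]/t^p`, with trivial module `k`, a Tate cohomology class of degree `m - n`
is a morphism `Ω^m(k) → Ω^n(k)` of the stable module category, and the product of Tate cohomology
classes is the composition of such morphisms. -/

section Stable

variable (A : Type u) [Ring A] (V W U : Type u) [AddCommGroup V] [Module A V]
  [AddCommGroup W] [Module A W] [AddCommGroup U] [Module A U]

/-- The subgroup of the `A`-linear maps `V → W` that factor through a finitely generated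
projective module. -/
def projectiveMaps : AddSubgroup (V →ₗ[A] W) where
  carrier := {f | ∃ (P : Type u) (_ : AddCommGroup P) (_ : Module A P)
    (g : V →ₗ[A] P) (h : P →ₗ[A] W), Module.Finite A P ∧ Module.Projective A P ∧ f = h ∘ₗ g}
  zero_mem' := ⟨PUnit, inferInstance, inferInstance, 0, 0, inferInstance, inferInstance, rfl⟩
  add_mem' := by
    rintro _ _ ⟨P, _, _, g, h, _, _, rfl⟩ ⟨P', _, _, g', h', _, _, rfl⟩
    exact ⟨P × P', inferInstance, inferInstance, g.prod g', h.coprod h', inferInstance,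
      inferInstance, (LinearMap.coprod_comp_prod _ _ _ _).symm⟩
  neg_mem' := by
    rintro _ ⟨P, _, _, g, h, _, _, rfl⟩
    exact ⟨P, inferInstance, inferInstance, g, -h, inferInstance, inferInstance,
      (LinearMap.neg_comp _ _).symm⟩

/-- The group of morphisms `V → W` in the stable module category of `A`. -/
abbrev StableHom : Type u := (V →ₗ[A] W) ⧸ projectiveMaps A V W

variable {A V W U}

/-- The class of a homomorphism in the stable module category. -/
def StableHom.mk (f : V →ₗ[A] W) : StableHom A V W := QuotientAddGroup.mk f

/-- Composition in the stable module category. -/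
def StableHom.comp (g : StableHom A W U) (f : StableHom A V W) : StableHom A V U :=
  Quotient.liftOn₂' g f (fun g f => StableHom.mk (g ∘ₗ f)) (by
    intro g f g' f' hg hf
    rw [QuotientAddGroup.leftRel_apply] at hg hf
    obtain ⟨P, _, _, a, b, _, _, h⟩ := hg
    obtain ⟨P', _, _, a', b', _, _, h'⟩ := hf
    refine QuotientAddGroup.eq.mpr ?_
    have e : -(g ∘ₗ f) + g' ∘ₗ f' = b ∘ₗ (a ∘ₗ f') + (g ∘ₗ b') ∘ₗ a' := by
      rw [← LinearMap.comp_assoc, ← h, LinearMap.comp_assoc, ← h']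
      simp only [LinearMap.add_comp, LinearMap.comp_add, LinearMap.neg_comp, LinearMap.comp_neg]
      abel
    rw [e]
    exact add_mem ⟨P, _, _, _, _, ‹_›, ‹_›, rfl⟩ ⟨P', _, _, _, _, ‹_›, ‹_›, rfl⟩)

end Stable

/-- Let `X j` be isomorphic in the stable category to `Ω^{m_j}(K)` and `Y i` to `Ω^{n_i}(K)`, over
`K[t]/t^p`, so that the entries `c i j : X j → Y i` of the matrix `c` are Tate cohomology classes
in `Ĥ^{m_j - n_i}(K[t]/t^p, K)`.  The matrix has rank `n`, the number of its rows, when its rows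
are linearly independent over the graded ring `Ĥ^*(K[t]/t^p, K)`: a linear relation
`∑ i, a i * c i j = 0` for all `j` forces all coefficients `a i` to vanish.  As the entry `c i j`
has degree `m_j - n_i`, the relation can be tested on its homogeneous components, in which `a i`
has degree `n_i - d` for a fixed `d : ℤ`, i.e. is a stable homomorphism `Y i → Ω^d(K)`. -/
def HasFullRowRank (K : Type u) [Field K] (p : ℕ) {m n : ℕ} {X : Fin m → Type u}
    {Y : Fin n → Type u} [∀ j, AddCommGroup (X j)] [∀ j, Module (Trunc K p) (X j)]
    [∀ i, AddCommGroup (Y i)] [∀ i, Module (Trunc K p) (Y i)]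
    (c : ∀ i j, StableHom (Trunc K p) (X j) (Y i)) : Prop :=
  ∀ (d : ℤ) (U : Type u) [AddCommGroup U] [Module (Trunc K p) U],
    IsHellerShift (Trunc K p) (JordanBlock K p 1) d U →
    ∀ a : ∀ i, StableHom (Trunc K p) (Y i) U,
      (∀ j, ∑ i, (a i).comp (c i j) = 0) → ∀ i, a i = 0

end

end FinGroupScheme

open FinGroupScheme

/-!
Why the restriction of `L` along a π-point `α : K[t]/t^p → KG` has the stated Jordan type.

Write `A = K[t]/t^p`. Restriction along `α` is exact, and it sends finitely generated projective
`kG`-modules to projective `A`-modules, because `KG` is flat over `A` (`projective_restrict`). It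
sends `k` to the block `[1]`. By Schanuel's lemma and its dual, it therefore sends `Ω^s(k)` to a
module which, up to projective summands, is `[1]` if `s` is even and `[p-1]` if `s` is odd
(`stablyEquivalent_of_isHellerShift`). For the negative shifts this needs that the injective hulls
over `kG` are projective and that projective `A`-modules are injective. The first point is
`projective_of_injective`: the coordinate algebra has a nonzero invariant integral `Λ`, obtained as
a trace (`exists_integral`), and `Λ` embeds every finitely generated module in a free one. The
second is Baer's criterion (`Trunc.injective_self`).

Stably, then, the restriction of `φ` is a map `[1]^m → [1]^n`. As the stable endomorphisms of `[1]`
are the scalars, this map is an `n × m` matrix over `K`. The rank hypothesis in degree `d = 0` says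
that its rows are linearly independent, so it has a right inverse (`exists_stable_right_inverse`).
Thus the restriction of `φ` has a section in the stable category, and hence, being surjective, an
honest section (`exists_section_of_stable_section`). So the restriction of `L`, plus `[1]^n`, plus a
free module, is `[1]^m` plus a free module.

To cancel, instead of the Krull–Schmidt theorem, the property `OnlyExtremeBlocks` is used. It passes
to direct summands and forces a module to be a sum of blocks `[1]` and `[p]`
(`OnlyExtremeBlocks.exists_equiv`); the number of blocks `[1]` is read off from dimensions
(`card_eq_of_equiv`). The number of blocks `[p]` is determined by `dim L`, so it does not depend on
the π-point.
-/

namespace FinGroupScheme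

/-! ### The invariant integral of a finite-dimensional commutative Hopf algebra -/

section Integral

open Coalgebra WithConv TensorProduct

variable {k R : Type u} [Field k] [CommRing R] [HopfAlgebra k R]

/-- The operator `y ↦ y₁ m(y₂)` on `k[G]` given by a functional `m ∈ kG`. -/
noncomputable def translate (m : GroupAlgebra k R) : R →ₗ[k] R :=
  (TensorProduct.rid k R).toLinearMap ∘ₗ m.ofConv.lTensor R ∘ₗ comul

theorem translate_apply (m : GroupAlgebra k R) (y : R) :
    translate m y = TensorProduct.rid k R (m.ofConv.lTensor R (comul y)) := rfl

/-- Translation on the right commutes with the comultiplication on the left. -/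
theorem lTensor_translate_comul (m : GroupAlgebra k R) (y : R) :
    (translate m).lTensor R (comul y) = comul (translate m y) := by
  have key : ∀ w : R ⊗[k] R, TensorProduct.rid k (R ⊗[k] R)
      (m.ofConv.lTensor (R ⊗[k] R) (comul.rTensor R w)) =
        comul (TensorProduct.rid k R (m.ofConv.lTensor R w)) := by
    intro w
    induction w with
    | zero => simp
    | add a b ha hb => simp only [map_add, ha, hb]
    | tmul a b => simp
  have key2 : ∀ w : (R ⊗[k] R) ⊗[k] R, (TensorProduct.rid k (R ⊗[k] R))
      (m.ofConv.lTensor (R ⊗[k] R) w) =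
      ((TensorProduct.rid k R).toLinearMap ∘ₗ m.ofConv.lTensor R).lTensor R
        (TensorProduct.assoc k R R R w) := by
    intro w
    induction w with
    | zero => simp
    | add a b ha hb => simp only [map_add, ha, hb]
    | tmul a b =>
      induction a with
      | zero => simp
      | add a c ha hb => simp only [map_add, TensorProduct.add_tmul, ha, hb]
      | tmul a c => simp
  rw [translate_apply, ← key, key2, coassoc_apply, ← LinearMap.lTensor_comp_apply]
  rfl

variable (k R) in
/-- The `k[G]`-linear endomorphism `a ⊗ x ↦ a x₁ ⊗ x₂` of `k[G] ⊗ k[G]`. -/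
noncomputable def shear : R ⊗[k] R →ₐ[R] R ⊗[k] R :=
  Algebra.TensorProduct.lift (Algebra.ofId R (R ⊗[k] R)) (Bialgebra.comulAlgHom k R)
    (fun _ _ => Commute.all _ _)

variable (k R) in
/-- The inverse `a ⊗ x ↦ a S(x₁) ⊗ x₂` of `shear`. -/
noncomputable def unshear : R ⊗[k] R →ₐ[R] R ⊗[k] R :=
  Algebra.TensorProduct.lift (Algebra.ofId R (R ⊗[k] R))
    ((Algebra.TensorProduct.map (HopfAlgebra.antipodeAlgHom k R) (AlgHom.id k R)).comp
      (Bialgebra.comulAlgHom k R)) (fun _ _ => Commute.all _ _)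

theorem shear_tmul (a x : R) : shear k R (a ⊗ₜ x) = (a ⊗ₜ 1) * comul x := by
  simp [shear, Algebra.ofId_apply]

theorem unshear_one_tmul (x : R) :
    unshear k R (1 ⊗ₜ x) = (HopfAlgebra.antipode k (A := R)).rTensor R (comul x) := by
  simp only [unshear, Algebra.TensorProduct.lift_tmul, map_one, one_mul]
  rfl

theorem shear_unshear (w : R ⊗[k] R) : shear k R (unshear k R w) = w := by
  suffices h : (shear k R).comp (unshear k R) = AlgHom.id R _ from DFunLike.congr_fun h w
  refine Algebra.TensorProduct.ext (by ext) ?_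
  refine AlgHom.ext fun x => ?_
  change shear k R (unshear k R (1 ⊗ₜ x)) = 1 ⊗ₜ x
  rw [unshear_one_tmul]
  have key : ∀ w : R ⊗[k] R,
      shear k R ((HopfAlgebra.antipode k (A := R)).rTensor R w) =
      ((LinearMap.mul' k R) ∘ₗ (HopfAlgebra.antipode k (A := R)).rTensor R).rTensor R
        ((TensorProduct.assoc k R R R).symm (comul.lTensor R w)) := by
    intro w
    induction w with
    | zero => simp
    | add a b ha hb => simp only [map_add, ha, hb]
    | tmul a b =>
      rw [LinearMap.rTensor_tmul, shear_tmul, LinearMap.lTensor_tmul]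
      induction (comul b : R ⊗[k] R) with
      | zero => simp
      | add x y hx hy => simp only [mul_add, map_add, TensorProduct.tmul_add, hx, hy]
      | tmul x y => simp
  rw [key, coassoc_symm_apply, ← LinearMap.comp_apply, ← LinearMap.rTensor_comp,
    LinearMap.comp_assoc, HopfAlgebra.mul_antipode_rTensor_comul, LinearMap.rTensor_comp,
    LinearMap.comp_apply, rTensor_counit_comul]
  simp

/-- The functional `s ↦ tr(translate m ∘ L_s)` on `k[G]`, with `L_s` multiplication by `s`. -/
noncomputable def traceIntegral (m : GroupAlgebra k R) : R →ₗ[k] k :=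
  LinearMap.trace k R ∘ₗ LinearMap.mulLeft k (translate m : Module.End k R) ∘ₗ LinearMap.mul k R

theorem traceIntegral_apply (m : GroupAlgebra k R) (s : R) :
    traceIntegral m s = LinearMap.trace k R (translate m ∘ₗ LinearMap.mulLeft k s) := rfl

variable [Module.Finite k R]

theorem trace_baseChange_comp_mulLeft (m : GroupAlgebra k R) (w : R ⊗[k] R) :
    LinearMap.trace R (R ⊗[k] R) ((translate m).baseChange R ∘ₗ LinearMap.mulLeft R w) =
      TensorProduct.rid k R ((traceIntegral m).lTensor R w) := by
  induction w with
  | zero => simp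
  | add a b ha hb =>
    have : LinearMap.mulLeft R (a + b) = LinearMap.mulLeft R a + LinearMap.mulLeft R b := by
      ext; simp [add_mul]
    rw [this, LinearMap.comp_add, map_add, ha, hb, map_add, map_add]
  | tmul a b =>
    have : (translate m).baseChange R ∘ₗ LinearMap.mulLeft R (a ⊗ₜ[k] b) =
        a • (translate m ∘ₗ LinearMap.mulLeft k b).baseChange R := by
      ext x
      simp [TensorProduct.smul_tmul']
    rw [this, map_smul, LinearMap.trace_baseChange, ← traceIntegral_apply]
    simp [Algebra.smul_def, mul_comm]

/-- Invariance `s₁ Λ(s₂) = Λ(s)` of `Λ = traceIntegral m`: the `k[G]`-linear automorphism `shear`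
conjugates the base change of `translate m ∘ L_s` into `(1 ⊗ translate m) ∘ L_{Δ(s)}`, and the traces
of these two operators are the two sides. -/
theorem rid_lTensor_traceIntegral_comul (m : GroupAlgebra k R) (s : R) :
    TensorProduct.rid k R ((traceIntegral m).lTensor R (comul s)) =
      algebraMap k R (traceIntegral m s) := by
  have hinv' : (shear k R).toLinearMap ∘ₗ (unshear k R).toLinearMap = LinearMap.id :=
    LinearMap.ext fun w => shear_unshear w
  have hinv : (unshear k R).toLinearMap ∘ₗ (shear k R).toLinearMap = LinearMap.id :=
    (mul_eq_one_comm (M := Module.End R (R ⊗[k] R))).mp hinv'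
  have hconj : ((translate m).baseChange R ∘ₗ LinearMap.mulLeft R (comul s)) ∘ₗ
      (shear k R).toLinearMap = (shear k R).toLinearMap ∘ₗ
        (translate m ∘ₗ LinearMap.mulLeft k s).baseChange R := by
    ext x
    simp only [AlgebraTensorModule.curry_apply, curry_apply,
      LinearMap.coe_comp, Function.comp_apply, AlgHom.toLinearMap_apply,
      LinearMap.coe_restrictScalars, LinearMap.baseChange_tmul, shear_tmul, LinearMap.mulLeft_apply,
      ← Algebra.TensorProduct.one_def, one_mul, ← lTensor_translate_comul, Bialgebra.comul_mul]
    rfl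
  rw [← trace_baseChange_comp_mulLeft, traceIntegral_apply,
    ← LinearMap.trace_baseChange _ R]
  symm
  rw [← LinearMap.id_comp ((translate m ∘ₗ LinearMap.mulLeft k s).baseChange R), ← hinv,
    LinearMap.comp_assoc, ← hconj, LinearMap.trace_comp_comm', LinearMap.comp_assoc, hinv',
    LinearMap.comp_id]

/-- A finite-dimensional commutative Hopf algebra has a nonzero invariant integral: one of the
`traceIntegral m` is nonzero, since the operator `x ↦ ε(x) 1 = x₁ S(x₂)`, of trace `1`, is a sum of
operators `L_{S(bᵢ)} ∘ translate bᵢ*`. -/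
theorem exists_integral : ∃ Λ : R →ₗ[k] k, Λ ≠ 0 ∧
    ∀ s, TensorProduct.rid k R (Λ.lTensor R (comul s)) = algebraMap k R (Λ s) := by
  by_contra! hno
  have h0 : ∀ m : GroupAlgebra k R, traceIntegral m = 0 := fun m => by
    by_contra h
    obtain ⟨s, hs⟩ := hno _ h
    exact hs (rid_lTensor_traceIntegral_comul m s)
  let b := Module.finBasis k R
  have key : ∑ i, LinearMap.mulLeft k (HopfAlgebra.antipode k (b i)) ∘ₗ
      translate (toConv (b.coord i)) = (counit (R := k) (A := R)).smulRight 1 := by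
    refine LinearMap.ext fun x => ?_
    have : ∀ w : R ⊗[k] R, ∑ i, HopfAlgebra.antipode k (b i) *
        TensorProduct.rid k R ((b.coord i).lTensor R w) =
          LinearMap.mul' k R ((HopfAlgebra.antipode k (A := R)).lTensor R w) := by
      intro w
      induction w with
      | zero => simp
      | add x y hx hy => simp only [map_add, mul_add, Finset.sum_add_distrib, hx, hy]
      | tmul y z =>
        have hz : HopfAlgebra.antipode k z = ∑ i, b.repr z i • HopfAlgebra.antipode k (b i) := by
          conv_lhs => rw [← b.sum_repr z]
          simp only [map_sum, map_smul]
        simp [hz, Finset.mul_sum, mul_comm]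
    simp [translate_apply, this, HopfAlgebra.mul_antipode_lTensor_comul_apply,
      Algebra.algebraMap_eq_smul_one]
  have := congrArg (LinearMap.trace k R) key
  simp only [map_sum] at this
  rw [Finset.sum_eq_zero] at this
  · rw [LinearMap.trace_smulRight] at this
    simp at this
  · intro i _
    rw [LinearMap.trace_comp_comm', ← traceIntegral_apply, h0, LinearMap.zero_apply]

/-- For a functional `Λ` on `k[G]`, the map `r ↦ (s ↦ Λ(r S(s)))` from `k[G]` to `kG`. -/
noncomputable def antipodePairing (Λ : R →ₗ[k] k) : R →ₗ[k] GroupAlgebra k R where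
  toFun r := toConv (Λ ∘ₗ LinearMap.mulLeft k r ∘ₗ HopfAlgebra.antipode k)
  map_add' x y := by ext; simp [add_mul]
  map_smul' c x := by ext; simp

omit [Module.Finite k R] in
theorem antipodePairing_apply (Λ : R →ₗ[k] k) (r s : R) :
    (antipodePairing Λ r).ofConv s = Λ (r * HopfAlgebra.antipode k s) := rfl

end Integral

/-! ### Injective modules over the group algebra are projective -/

section Frobenius

open Coalgebra WithConv TensorProduct

variable {k R : Type u} [Field k] [CommRing R] [HopfAlgebra k R]

theorem algHom_mul_algHom_antipode {B : Type u} [CommRing B] [Algebra k B] (f : R →ₐ[k] B) :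
    toConv f.toLinearMap * toConv (f.toLinearMap ∘ₗ HopfAlgebra.antipode k) = 1 := by
  have h := LinearMap.algHom_comp_convMul_distrib f (toConv (LinearMap.id : R →ₗ[k] R))
    (toConv (HopfAlgebra.antipode k (A := R)))
  rw [LinearMap.id_mul_antipode] at h
  apply WithConv.ext
  refine Eq.trans h.symm ?_
  ext x
  simp

/-- `Δ(S(s₁)) (s₂ ⊗ 1) = 1 ⊗ S(s)`. -/
theorem comul_antipode_mul_includeLeft :
    toConv ((Bialgebra.comulAlgHom k R).toLinearMap ∘ₗ HopfAlgebra.antipode k) *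
        toConv (Algebra.TensorProduct.includeLeft : R →ₐ[k] R ⊗[k] R).toLinearMap =
      toConv ((Algebra.TensorProduct.includeRight : R →ₐ[k] R ⊗[k] R).toLinearMap ∘ₗ
        HopfAlgebra.antipode k) := by
  have hcomul : toConv (Algebra.TensorProduct.includeLeft : R →ₐ[k] R ⊗[k] R).toLinearMap *
      toConv (Algebra.TensorProduct.includeRight : R →ₐ[k] R ⊗[k] R).toLinearMap =
      toConv (Bialgebra.comulAlgHom k R).toLinearMap := by
    apply WithConv.ext
    refine LinearMap.ext fun x => ?_
    change LinearMap.mul' k _ (TensorProduct.map _ _ (comul x)) = comul x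
    generalize (comul x : R ⊗[k] R) = w
    induction w with
    | zero => simp
    | add x y hx hy => simp only [map_add, hx, hy]
    | tmul x y => simp
  have h1 := algHom_mul_algHom_antipode (Bialgebra.comulAlgHom k R)
  have h2 := algHom_mul_algHom_antipode
    (Algebra.TensorProduct.includeRight : R →ₐ[k] R ⊗[k] R)
  have h1' : toConv ((Bialgebra.comulAlgHom k R).toLinearMap ∘ₗ HopfAlgebra.antipode k) *
      toConv (Bialgebra.comulAlgHom k R).toLinearMap = 1 := by
    have h := LinearMap.algHom_comp_convMul_distrib (Bialgebra.comulAlgHom k R)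
      (toConv (HopfAlgebra.antipode k (A := R))) (toConv (LinearMap.id : R →ₗ[k] R))
    rw [LinearMap.antipode_mul_id] at h
    apply WithConv.ext
    refine Eq.trans h.symm ?_
    ext x
    simp
  calc _ = _ * (toConv (Algebra.TensorProduct.includeLeft : R →ₐ[k] R ⊗[k] R).toLinearMap *
            (toConv (Algebra.TensorProduct.includeRight : R →ₐ[k] R ⊗[k] R).toLinearMap *
            toConv ((Algebra.TensorProduct.includeRight : R →ₐ[k] R ⊗[k] R).toLinearMap ∘ₗ
        HopfAlgebra.antipode k))) := by rw [h2, mul_one]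
    _ = _ := by rw [← mul_assoc (toConv (AlgHom.toLinearMap _)), hcomul, ← mul_assoc, h1', one_mul]

/-- If `Λ` is an invariant integral, then `B(r) h = h(r₁) B(r₂)` for all `h ∈ kG`, with
`B = antipodePairing Λ`. -/
theorem antipodePairing_mul {Λ : R →ₗ[k] k}
    (hΛ : ∀ s, TensorProduct.rid k R (Λ.lTensor R (comul s)) = algebraMap k R (Λ s))
    (r : R) (h : GroupAlgebra k R) :
    antipodePairing Λ r * h =
      antipodePairing Λ (TensorProduct.lid k R (h.ofConv.rTensor R (comul r))) := by
  -- the functional `a ⊗ b ↦ h(a) Λ(b)`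
  let θ : R ⊗[k] R →ₗ[k] k := LinearMap.mul' k k ∘ₗ TensorProduct.map h.ofConv Λ
  have hθ : ∀ a b : R, θ (a ⊗ₜ b) = h.ofConv a * Λ b := fun a b => rfl
  have inv : ∀ a u : R, Λ u * h.ofConv a = θ (comul u * (a ⊗ₜ 1)) := by
    intro a u
    have : ∀ w : R ⊗[k] R, θ (w * (a ⊗ₜ 1)) =
        h.ofConv (TensorProduct.rid k R (Λ.lTensor R w) * a) := by
      intro w
      induction w with
      | zero => simp
      | add x y hx hy => simp only [add_mul, map_add, hx, hy]
      | tmul x y => simp [hθ, mul_comm]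
    rw [this, hΛ, ← Algebra.smul_def, map_smul, smul_eq_mul]
  apply WithConv.ext
  refine LinearMap.ext fun s => ?_
  have lhs : ∀ w : R ⊗[k] R,
      LinearMap.mul' k k (TensorProduct.map (antipodePairing Λ r).ofConv h.ofConv w) =
        θ (comul r * LinearMap.mul' k (R ⊗[k] R) (TensorProduct.map
          ((Bialgebra.comulAlgHom k R).toLinearMap ∘ₗ HopfAlgebra.antipode k)
          (Algebra.TensorProduct.includeLeft : R →ₐ[k] R ⊗[k] R).toLinearMap w)) := by
    intro w
    induction w with
    | zero => simp
    | add x y hx hy => simp only [map_add, mul_add, hx, hy]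
    | tmul x y =>
      rw [TensorProduct.map_tmul, LinearMap.mul'_apply, antipodePairing_apply, inv,
        Bialgebra.comul_mul]
      simp [mul_assoc]
  have rhs : ∀ w : R ⊗[k] R, θ (w * (1 ⊗ₜ HopfAlgebra.antipode k s)) =
      Λ (TensorProduct.lid k R (h.ofConv.rTensor R w) * HopfAlgebra.antipode k s) := by
    intro w
    induction w with
    | zero => simp
    | add x y hx hy => simp only [map_add, add_mul, hx, hy]
    | tmul x y => simp [hθ]
  have hs := congrArg (fun f => f.ofConv s) (comul_antipode_mul_includeLeft (k := k) (R := R))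
  simp only [LinearMap.convMul_apply] at hs
  rw [LinearMap.convMul_apply, lhs, hs, antipodePairing_apply, ← rhs]
  rfl

variable [Module.Finite k R]

/-- The elements `antipodePairing Λ r` generate the left ideal `kG` if `Λ ≠ 0`, because
`∑ bᵢ* B(r bᵢ) = Λ(r) ε` for a basis `bᵢ`, with `B = antipodePairing Λ`. -/
theorem sum_coord_mul_antipodePairing (Λ : R →ₗ[k] k) (r : R) :
    ∑ i, (toConv ((Module.finBasis k R).coord i) : GroupAlgebra k R) *
        antipodePairing Λ (r * Module.finBasis k R i) =
      algebraMap k (GroupAlgebra k R) (Λ r) := by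
  set b := Module.finBasis k R
  apply WithConv.ext
  refine LinearMap.ext fun s => ?_
  have key : ∀ w : R ⊗[k] R, ∑ i, LinearMap.mul' k k (TensorProduct.map (b.coord i)
      (antipodePairing Λ (r * b i)).ofConv w) =
        Λ (r * LinearMap.mul' k R ((HopfAlgebra.antipode k (A := R)).lTensor R w)) := by
    intro w
    induction w with
    | zero => simp
    | add x y hx hy => simp only [map_add, mul_add, Finset.sum_add_distrib, hx, hy]
    | tmul x y =>
      conv_rhs => rw [← b.sum_repr x]
      simp only [TensorProduct.map_tmul, LinearMap.mul'_apply, antipodePairing_apply,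
        LinearMap.lTensor_tmul, Finset.sum_mul, Finset.mul_sum, map_sum, Module.Basis.coord_apply,
        smul_mul_assoc, mul_smul_comm, map_smul, smul_eq_mul, mul_assoc]
  have e : ∀ f : Fin (Module.finrank k R) → GroupAlgebra k R, (∑ i, f i).ofConv s =
      ∑ i, (f i).ofConv s := fun f =>
    map_sum (LinearMap.applyₗ s ∘ₗ (WithConv.linearEquiv k (R →ₗ[k] k)).toLinearMap) f _
  rw [e]
  simp only [LinearMap.convMul_apply]
  rw [key, HopfAlgebra.mul_antipode_lTensor_comul_apply]
  simp [Algebra.algebraMap_eq_smul_one, mul_comm]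

/-- The group algebra of a finite group scheme is quasi-Frobenius: a finitely generated injective
module embeds in a free module, by means of an invariant integral. -/
theorem projective_of_injective (I : Type u) [AddCommGroup I] [Module (GroupAlgebra k R) I]
    [Module.Finite (GroupAlgebra k R) I] [Module.Injective (GroupAlgebra k R) I] :
    Module.Projective (GroupAlgebra k R) I := by
  obtain ⟨Λ, hΛ0, hΛ⟩ := exists_integral (k := k) (R := R)
  let _ : Module k I := Module.compHom I (algebraMap k (GroupAlgebra k R))
  have : IsScalarTower k (GroupAlgebra k R) I := ⟨fun c a x => by
    rw [Algebra.smul_def, mul_smul]; rfl⟩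
  have : Module.Finite k (GroupAlgebra k R) :=
    Module.Finite.equiv (WithConv.linearEquiv k (R →ₗ[k] k)).symm
  have : Module.Finite k I := Module.Finite.trans (GroupAlgebra k R) I
  let b := Module.finBasis k I
  let act : R →ₗ[k] I →ₗ[k] I :=
    (Algebra.lsmul k k I).toLinearMap ∘ₗ antipodePairing Λ
  let φ : I →ₗ[GroupAlgebra k R] (Fin (Module.finrank k I) → GroupAlgebra k R) :=
    { toFun := fun x i => toConv (b.coord i ∘ₗ act.flip x)
      map_add' := fun x y => by ext; simp
      map_smul' := fun h x => by
        ext i r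
        have key : ∀ w : R ⊗[k] R,
            b.coord i (antipodePairing Λ (TensorProduct.lid k R (h.ofConv.rTensor R w)) • x) =
            LinearMap.mul' k k (TensorProduct.map h.ofConv (b.coord i ∘ₗ act.flip x) w) := by
          intro w
          induction w with
          | zero =>
            simp only [map_zero]
            exact (congrArg (b.coord i) (zero_smul (GroupAlgebra k R) x)).trans (map_zero _)
          | add x y hx hy => simp only [map_add, add_smul, hx, hy]
          | tmul y z => simp [act]
        change b.coord i (antipodePairing Λ r • h • x) =
          LinearMap.mul' k k (TensorProduct.map h.ofConv (b.coord i ∘ₗ act.flip x) (comul r))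
        rw [← mul_smul, antipodePairing_mul hΛ, key] }
  have hφ : Function.Injective φ := by
    rw [injective_iff_map_eq_zero]
    intro x hx
    have h0 : ∀ r, antipodePairing Λ r • x = 0 := fun r => by
      apply b.repr.injective
      ext i
      have := congrArg (fun f => (f i).ofConv r) hx
      simpa [φ, act] using this
    obtain ⟨r, hr⟩ : ∃ r, Λ r ≠ 0 := by
      by_contra! h
      exact hΛ0 (LinearMap.ext h)
    have := congrArg (fun a => a • x) (sum_coord_mul_antipodePairing Λ r)
    simp only [Finset.sum_smul, mul_smul, h0, smul_zero, Finset.sum_const_zero] at this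
    rw [algebraMap_smul] at this
    exact (smul_eq_zero.mp this.symm).resolve_left hr
  obtain ⟨ρ, hρ⟩ := Module.Injective.out φ hφ LinearMap.id
  exact Module.Projective.of_split φ ρ (LinearMap.ext hρ)

end Frobenius

/-! ### Schanuel's lemma and stable equivalence -/

section Schanuel

variable {A : Type u} [Ring A]
  {V P W V' P' : Type u} [AddCommGroup V] [Module A V] [AddCommGroup P] [Module A P]
  [AddCommGroup W] [Module A W] [AddCommGroup V'] [Module A V'] [AddCommGroup P'] [Module A P']

theorem nonempty_equiv_prod_of_projective {f : V →ₗ[A] P} {g : P →ₗ[A] W}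
    (hf : Function.Injective f) (h : Function.Exact f g) (hg : Function.Surjective g)
    [Module.Projective A W] : Nonempty (P ≃ₗ[A] V × W) := by
  obtain ⟨s, hs⟩ := Module.projective_lifting_property g LinearMap.id hg
  exact ⟨(h.splitSurjectiveEquiv hf ⟨s, hs⟩).1⟩

theorem nonempty_equiv_prod_of_injective {f : V →ₗ[A] P} {g : P →ₗ[A] W}
    (hf : Function.Injective f) (h : Function.Exact f g) (hg : Function.Surjective g)
    [Module.Injective A V] : Nonempty (P ≃ₗ[A] V × W) := by
  obtain ⟨r, hr⟩ := Module.Injective.out f hf LinearMap.id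
  exact ⟨(h.splitInjectiveEquiv hg ⟨r, LinearMap.ext hr⟩).1⟩

/-- Schanuel's lemma. -/
theorem schanuel {f : V →ₗ[A] P} {g : P →ₗ[A] W} {f' : V' →ₗ[A] P'} {g' : P' →ₗ[A] W}
    (hf : Function.Injective f) (h : Function.Exact f g) (hg : Function.Surjective g)
    (hf' : Function.Injective f') (h' : Function.Exact f' g') (hg' : Function.Surjective g')
    [Module.Projective A P] [Module.Projective A P'] :
    Nonempty ((V × P') ≃ₗ[A] V' × P) := by
  -- both sides are isomorphic to the pullback of `g` and `g'`
  let Z := LinearMap.eqLocus (g ∘ₗ LinearMap.fst A P P') (g' ∘ₗ LinearMap.snd A P P')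
  let i : V →ₗ[A] Z := ((LinearMap.inl A P P') ∘ₗ f).codRestrict Z
    fun x => by simp [Z, h.apply_apply_eq_zero]
  let i' : V' →ₗ[A] Z := ((LinearMap.inr A P P') ∘ₗ f').codRestrict Z
    fun x => by simp [Z, h'.apply_apply_eq_zero]
  let q : Z →ₗ[A] P := LinearMap.fst A P P' ∘ₗ Z.subtype
  let q' : Z →ₗ[A] P' := LinearMap.snd A P P' ∘ₗ Z.subtype
  obtain ⟨e⟩ : Nonempty (Z ≃ₗ[A] V × P') := by
    refine nonempty_equiv_prod_of_projective (f := i) (g := q') ?_ ?_ ?_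
    · intro x y hxy
      exact hf (congrArg (fun z : Z => z.1.1) hxy)
    · rintro ⟨⟨x, y⟩, hz⟩
      have hz : g x = g' y := hz
      constructor
      · intro hy
        have hy : y = 0 := hy
        obtain ⟨v, rfl⟩ := (h x).mp (by rw [hz, hy, map_zero])
        exact ⟨v, Subtype.ext (Prod.ext rfl hy.symm)⟩
      · rintro ⟨v, hv⟩
        exact (congrArg (fun z : Z => z.1.2) hv).symm
    · intro y
      obtain ⟨x, hx⟩ := hg (g' y)
      exact ⟨⟨(x, y), hx⟩, rfl⟩
  obtain ⟨e'⟩ : Nonempty (Z ≃ₗ[A] V' × P) := by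
    refine nonempty_equiv_prod_of_projective (f := i') (g := q) ?_ ?_ ?_
    · intro x y hxy
      exact hf' (congrArg (fun z : Z => z.1.2) hxy)
    · rintro ⟨⟨x, y⟩, hz⟩
      have hz : g x = g' y := hz
      constructor
      · intro hx
        have hx : x = 0 := hx
        obtain ⟨v, rfl⟩ := (h' y).mp (by rw [← hz, hx, map_zero])
        exact ⟨v, Subtype.ext (Prod.ext hx.symm rfl)⟩
      · rintro ⟨v, hv⟩
        exact (congrArg (fun z : Z => z.1.1) hv).symm
    · intro x
      obtain ⟨y, hy⟩ := hg' (g x)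
      exact ⟨⟨(x, y), hy.symm⟩, rfl⟩
  exact ⟨e.symm.trans e'⟩

/-- The dual of Schanuel's lemma. -/
theorem schanuel_dual {f : W →ₗ[A] P} {g : P →ₗ[A] V} {f' : W →ₗ[A] P'} {g' : P' →ₗ[A] V'}
    (hf : Function.Injective f) (h : Function.Exact f g) (hg : Function.Surjective g)
    (hf' : Function.Injective f') (h' : Function.Exact f' g') (hg' : Function.Surjective g')
    [Module.Injective A P] [Module.Injective A P'] :
    Nonempty ((V × P') ≃ₗ[A] V' × P) := by
  -- both sides are isomorphic to the pushout of `f` and `f'`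
  let D := LinearMap.range (f.prod (-f'))
  have hD : ∀ x y, (x, y) ∈ D ↔ ∃ w, f w = x ∧ -f' w = y := fun x y => by
    simp [D, LinearMap.mem_range]
  let i : P →ₗ[A] (P × P') ⧸ D := D.mkQ ∘ₗ LinearMap.inl A P P'
  let i' : P' →ₗ[A] (P × P') ⧸ D := D.mkQ ∘ₗ LinearMap.inr A P P'
  let q : (P × P') ⧸ D →ₗ[A] V := D.liftQ (g ∘ₗ LinearMap.fst A P P') (by
    rintro _ ⟨w, rfl⟩
    simp [h.apply_apply_eq_zero])
  let q' : (P × P') ⧸ D →ₗ[A] V' := D.liftQ (g' ∘ₗ LinearMap.snd A P P') (by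
    rintro _ ⟨w, rfl⟩
    simp [h'.apply_apply_eq_zero])
  obtain ⟨e⟩ : Nonempty (((P × P') ⧸ D) ≃ₗ[A] P' × V) := by
    refine nonempty_equiv_prod_of_injective (f := i') (g := q) ?_ ?_ ?_
    · rw [injective_iff_map_eq_zero]
      intro y hy
      obtain ⟨w, hw, rfl⟩ := (hD 0 y).mp ((Submodule.Quotient.mk_eq_zero D).mp hy)
      rw [(map_eq_zero_iff f hf).mp hw, map_zero, neg_zero]
    · intro z
      obtain ⟨⟨x, y⟩, rfl⟩ := D.mkQ_surjective z
      constructor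
      · intro hx
        obtain ⟨w, rfl⟩ := (h x).mp hx
        refine ⟨y + f' w, (Submodule.Quotient.eq D).mpr ?_⟩
        exact (hD _ _).mpr ⟨-w, by simp, by simp⟩
      · rintro ⟨y', hy'⟩
        rw [← hy']
        simp [q, i']
    · intro v
      obtain ⟨x, rfl⟩ := hg v
      exact ⟨D.mkQ (x, 0), rfl⟩
  obtain ⟨e'⟩ : Nonempty (((P × P') ⧸ D) ≃ₗ[A] P × V') := by
    refine nonempty_equiv_prod_of_injective (f := i) (g := q') ?_ ?_ ?_
    · rw [injective_iff_map_eq_zero]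
      intro x hx
      obtain ⟨w, rfl, hw⟩ := (hD x 0).mp ((Submodule.Quotient.mk_eq_zero D).mp hx)
      rw [(map_eq_zero_iff f' hf').mp (neg_eq_zero.mp hw), map_zero]
    · intro z
      obtain ⟨⟨x, y⟩, rfl⟩ := D.mkQ_surjective z
      constructor
      · intro hx
        obtain ⟨w, rfl⟩ := (h' y).mp hx
        refine ⟨x + f w, (Submodule.Quotient.eq D).mpr ?_⟩
        exact (hD _ _).mpr ⟨w, by simp, by simp⟩
      · rintro ⟨y', hy'⟩
        rw [← hy']
        simp [q', i]
    · intro v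
      obtain ⟨x, rfl⟩ := hg' v
      exact ⟨D.mkQ (0, x), rfl⟩
  exact ⟨(LinearEquiv.prodComm A V P').trans
    (e.symm.trans (e'.trans (LinearEquiv.prodComm A P V')))⟩

variable (A V W) in
/-- `V` and `W` become isomorphic after adding finitely generated projective modules. -/
def StablyEquivalent : Prop :=
  ∃ (F : Type u) (_ : AddCommGroup F) (_ : Module A F)
    (F' : Type u) (_ : AddCommGroup F') (_ : Module A F'),
    (Module.Finite A F ∧ Module.Projective A F) ∧ (Module.Finite A F' ∧ Module.Projective A F') ∧
    Nonempty ((V × F) ≃ₗ[A] W × F')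

theorem StablyEquivalent.of_equiv (e : V ≃ₗ[A] W) : StablyEquivalent A V W :=
  ⟨PUnit, inferInstance, inferInstance, PUnit, inferInstance, inferInstance,
    ⟨inferInstance, inferInstance⟩, ⟨inferInstance, inferInstance⟩,
    ⟨LinearEquiv.prodCongr e (LinearEquiv.refl _ _)⟩⟩

theorem exact_prodMap_id {F : Type u} [AddCommGroup F] [Module A F] {f : V →ₗ[A] P}
    {g : P →ₗ[A] W} (h : Function.Exact f g) :
    Function.Exact (LinearMap.inl A P F ∘ₗ f) (g.prodMap (LinearMap.id : F →ₗ[A] F)) := by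
  rintro ⟨x, y⟩
  constructor
  · intro hxy
    obtain ⟨v, hv⟩ := (h x).mp (congrArg Prod.fst hxy)
    have hy : y = 0 := congrArg Prod.snd hxy
    exact ⟨v, Prod.ext hv hy.symm⟩
  · rintro ⟨v, hv⟩
    rw [← hv]
    simp [h.apply_apply_eq_zero]

theorem exact_prodMap_id_left {F : Type u} [AddCommGroup F] [Module A F] {f : V →ₗ[A] P}
    {g : P →ₗ[A] W} (h : Function.Exact f g) :
    Function.Exact (f.prodMap (LinearMap.id : F →ₗ[A] F)) (g ∘ₗ LinearMap.fst A P F) := by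
  rintro ⟨x, y⟩
  constructor
  · intro hxy
    obtain ⟨v, hv⟩ := (h x).mp hxy
    exact ⟨(v, y), Prod.ext hv rfl⟩
  · rintro ⟨v, hv⟩
    rw [← hv]
    simp [h.apply_apply_eq_zero]

/-- Kernels of surjections from projective modules onto stably equivalent modules are stably
equivalent. -/
theorem StablyEquivalent.kernel {W' : Type u} [AddCommGroup W'] [Module A W']
    {f : V →ₗ[A] P} {g : P →ₗ[A] W} {f' : V' →ₗ[A] P'} {g' : P' →ₗ[A] W'}
    (hf : Function.Injective f) (h : Function.Exact f g) (hg : Function.Surjective g)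
    (hf' : Function.Injective f') (h' : Function.Exact f' g') (hg' : Function.Surjective g')
    [Module.Finite A P] [Module.Finite A P']
    [Module.Projective A P] [Module.Projective A P'] (hW : StablyEquivalent A W W') :
    StablyEquivalent A V V' := by
  obtain ⟨F, _, _, F', _, _, ⟨_, _⟩, ⟨_, _⟩, ⟨e⟩⟩ := hW
  have h1 := exact_prodMap_id (F := F) h
  have h2 := exact_prodMap_id (F := F') h'
  have h2' : Function.Exact (LinearMap.inl A P' F' ∘ₗ f')
      (e.symm.toLinearMap ∘ₗ g'.prodMap (LinearMap.id : F' →ₗ[A] F')) := fun x => by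
    rw [← h2 x]; simp
  obtain ⟨e'⟩ := schanuel (LinearMap.inl_injective.comp hf) h1
    (Function.Surjective.prodMap hg Function.surjective_id) (LinearMap.inl_injective.comp hf') h2'
    (e.symm.surjective.comp (Function.Surjective.prodMap hg' Function.surjective_id))
  exact ⟨P' × F', _, _, P × F, _, _, ⟨inferInstance, inferInstance⟩,
    ⟨inferInstance, inferInstance⟩, ⟨e'⟩⟩

/-- If finitely generated projective modules are injective, then cokernels of embeddings of stably
equivalent modules into projective modules are stably equivalent. -/
theorem StablyEquivalent.cokernel {W' : Type u} [AddCommGroup W'] [Module A W']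
    (hinj : ∀ (F : Type u) [AddCommGroup F] [Module A F], Module.Finite A F →
      Module.Projective A F → Module.Injective A F)
    {f : W →ₗ[A] P} {g : P →ₗ[A] V} {f' : W' →ₗ[A] P'} {g' : P' →ₗ[A] V'}
    (hf : Function.Injective f) (h : Function.Exact f g) (hg : Function.Surjective g)
    (hf' : Function.Injective f') (h' : Function.Exact f' g') (hg' : Function.Surjective g')
    [Module.Finite A P] [Module.Finite A P']
    [Module.Projective A P] [Module.Projective A P'] (hW : StablyEquivalent A W W') :
    StablyEquivalent A V V' := by
  obtain ⟨F, _, _, F', _, _, ⟨_, _⟩, ⟨_, _⟩, ⟨e⟩⟩ := hW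
  have := hinj (P × F) inferInstance inferInstance
  have := hinj (P' × F') inferInstance inferInstance
  have h1 := exact_prodMap_id_left (F := F) h
  have h2 := exact_prodMap_id_left (F := F') h'
  have h2' : Function.Exact (f'.prodMap (LinearMap.id : F' →ₗ[A] F') ∘ₗ e.toLinearMap)
      (g' ∘ₗ LinearMap.fst A P' F') := fun x => by
    rw [h2 x, LinearMap.coe_comp, LinearEquiv.coe_coe, e.surjective.range_comp]
  obtain ⟨e'⟩ := schanuel_dual (Function.Injective.prodMap hf Function.injective_id) h1
    (hg.comp LinearMap.fst_surjective)
    ((Function.Injective.prodMap hf' Function.injective_id).comp e.injective) h2'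
    (hg'.comp LinearMap.fst_surjective)
  exact ⟨P' × F', _, _, P × F, _, _, ⟨inferInstance, inferInstance⟩,
    ⟨inferInstance, inferInstance⟩, ⟨e'⟩⟩

theorem projective_pi {ι : Type*} [Finite ι] {X : ι → Type*} [∀ i, AddCommGroup (X i)]
    [∀ i, Module A (X i)] [∀ i, Module.Projective A (X i)] : Module.Projective A (∀ i, X i) := by
  classical
  have := Fintype.ofFinite ι
  exact Module.Projective.of_equiv (DFinsupp.linearEquivFunOnFintype (R := A) (M := X))

theorem StablyEquivalent.pi {m : ℕ} {X X' : Fin m → Type u}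
    [∀ i, AddCommGroup (X i)] [∀ i, Module A (X i)]
    [∀ i, AddCommGroup (X' i)] [∀ i, Module A (X' i)]
    (h : ∀ i, StablyEquivalent A (X i) (X' i)) : StablyEquivalent A (∀ i, X i) (∀ i, X' i) := by
  choose F _ _ F' _ _ hF hF' e using h
  have := fun i => (hF i).1
  have := fun i => (hF i).2
  have := fun i => (hF' i).1
  have := fun i => (hF' i).2
  let e := fun i => (e i).some
  refine ⟨∀ i, F i, inferInstance, inferInstance, ∀ i, F' i, inferInstance, inferInstance,
    ⟨inferInstance, projective_pi⟩, ⟨inferInstance, projective_pi⟩, ⟨?_⟩⟩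
  refine
    { toFun := fun x => (fun i => (e i (x.1 i, x.2 i)).1, fun i => (e i (x.1 i, x.2 i)).2)
      invFun := fun x => (fun i => ((e i).symm (x.1 i, x.2 i)).1,
        fun i => ((e i).symm (x.1 i, x.2 i)).2)
      map_add' := fun x y => ?_
      map_smul' := fun c x => ?_
      left_inv := fun x => ?_
      right_inv := fun x => ?_ }
  · refine Prod.ext (funext fun i => ?_) (funext fun i => ?_)
    · exact congrArg Prod.fst ((e i).map_add (x.1 i, x.2 i) (y.1 i, y.2 i))
    · exact congrArg Prod.snd ((e i).map_add (x.1 i, x.2 i) (y.1 i, y.2 i))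
  · refine Prod.ext (funext fun i => ?_) (funext fun i => ?_)
    · exact congrArg Prod.fst ((e i).map_smul c (x.1 i, x.2 i))
    · exact congrArg Prod.snd ((e i).map_smul c (x.1 i, x.2 i))
  · ext i <;> simp
  · ext i <;> simp

end Schanuel

/-! ### The algebra `K[t]/t^p` and its blocks -/

section Trunc

variable {K : Type u} [Field K] {p : ℕ}

theorem Trunc.mk_surjective (a : Trunc K p) :
    ∃ f : K[X], Ideal.Quotient.mk (Ideal.span {(Polynomial.X : K[X]) ^ p}) f = a :=
  Ideal.Quotient.mk_surjective a

theorem Trunc.mk_eq_zero (f : K[X]) :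
    (Ideal.Quotient.mk (Ideal.span {(Polynomial.X : K[X]) ^ p}) f = 0) ↔ Polynomial.X ^ p ∣ f := by
  rw [Ideal.Quotient.eq_zero_iff_mem, Ideal.mem_span_singleton]

theorem Trunc.t_pow_eq_mk (i : ℕ) :
    Trunc.t K p ^ i = Ideal.Quotient.mk _ ((Polynomial.X : K[X]) ^ i) := by
  rw [map_pow]; rfl

theorem Trunc.t_pow_self : Trunc.t K p ^ p = 0 := by
  rw [Trunc.t_pow_eq_mk, Trunc.mk_eq_zero]

/-- The annihilator of `t^j` is the ideal `(t^i)`, for `i + j = p`. -/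
theorem Trunc.t_pow_mul_eq_zero {i j : ℕ} (hij : i + j = p) (a : Trunc K p) :
    Trunc.t K p ^ j * a = 0 ↔ Trunc.t K p ^ i ∣ a := by
  constructor
  · intro h
    obtain ⟨f, rfl⟩ := Trunc.mk_surjective a
    rw [Trunc.t_pow_eq_mk, ← map_mul, Trunc.mk_eq_zero, ← hij, add_comm, pow_add,
      mul_dvd_mul_iff_left (pow_ne_zero _ Polynomial.X_ne_zero)] at h
    rw [Trunc.t_pow_eq_mk]
    exact map_dvd _ h
  · rintro ⟨b, rfl⟩
    rw [← mul_assoc, ← pow_add, add_comm, hij, Trunc.t_pow_self, zero_mul]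

theorem Trunc.exists_eq_t_pow_mul_unit {a : Trunc K p} (ha : a ≠ 0) :
    ∃ i < p, ∃ u : (Trunc K p)ˣ, a = Trunc.t K p ^ i * u := by
  obtain ⟨f, rfl⟩ := Trunc.mk_surjective a
  have hf : f ≠ 0 := by rintro rfl; exact ha (map_zero _)
  obtain ⟨i, g, hg, rfl⟩ := WfDvdMonoid.max_power_factor hf Polynomial.irreducible_X
  have hip : i < p := by
    by_contra! h
    exact ha ((Trunc.mk_eq_zero _).mpr (Dvd.dvd.mul_right (pow_dvd_pow _ h) _))
  have hu : IsUnit (Ideal.Quotient.mk (Ideal.span {(Polynomial.X : K[X]) ^ p}) g) := by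
    obtain ⟨x, y, hxy⟩ := ((Polynomial.irreducible_X.coprime_iff_not_dvd).mpr hg).pow_left (m := p)
    refine IsUnit.of_mul_eq_one (Ideal.Quotient.mk _ y) ?_
    have := congrArg (Ideal.Quotient.mk (Ideal.span {(Polynomial.X : K[X]) ^ p})) hxy
    rw [map_add, (Trunc.mk_eq_zero (x * _)).mpr (dvd_mul_left _ _), zero_add, map_mul,
      map_one] at this
    rw [mul_comm, this]
  exact ⟨i, hip, hu.unit, by rw [Trunc.t_pow_eq_mk, map_mul]; rfl⟩

theorem Trunc.finrank : Module.finrank K (Trunc K p) = p := by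
  rw [finrank_quotient_span_eq_natDegree, Polynomial.natDegree_X_pow]

instance : Module.Finite K (Trunc K p) :=
  (Polynomial.Monic.finite_quotient (Polynomial.monic_X_pow p))

instance [NeZero p] : Nontrivial (Trunc K p) := by
  refine Module.nontrivial_of_finrank_pos (R := K) ?_
  rw [Trunc.finrank]
  exact Nat.pos_of_ne_zero (NeZero.ne p)

theorem Trunc.isUnit_or_t_dvd (a : Trunc K p) : IsUnit a ∨ Trunc.t K p ∣ a := by
  rcases eq_or_ne a 0 with rfl | ha
  · exact Or.inr (dvd_zero _)
  · obtain ⟨i, hi, u, rfl⟩ := Trunc.exists_eq_t_pow_mul_unit ha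
    rcases Nat.eq_zero_or_pos i with rfl | h
    · left; simp
    · right; exact Dvd.dvd.mul_right (dvd_pow_self _ h.ne') _

theorem Trunc.not_isUnit_of_t_dvd [NeZero p] {a : Trunc K p} (h : Trunc.t K p ∣ a) :
    ¬ IsUnit a := fun hu => by
  have h1 : IsUnit (Trunc.t K p) := isUnit_of_dvd_unit h hu
  have h2 : IsUnit (Trunc.t K p ^ p) := h1.pow p
  rw [Trunc.t_pow_self] at h2
  exact not_isUnit_zero h2

instance [NeZero p] : IsLocalRing (Trunc K p) :=
  IsLocalRing.of_nonunits_add fun a b ha hb => Trunc.not_isUnit_of_t_dvd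
    (dvd_add ((Trunc.isUnit_or_t_dvd a).resolve_left ha)
      ((Trunc.isUnit_or_t_dvd b).resolve_left hb))

/-- `K[t]/t^p` is self-injective, by Baer's criterion. -/
theorem Trunc.injective_self : Module.Injective (Trunc K p) (Trunc K p) := by
  refine Module.Baer.injective fun I g => ?_
  have : IsPrincipalIdealRing (Trunc K p) :=
    IsPrincipalIdealRing.of_surjective _ (Ideal.Quotient.mk_surjective
      (I := Ideal.span {(Polynomial.X : K[X]) ^ p}))
  obtain ⟨a, rfl⟩ : ∃ a, I = Ideal.span {a} := (IsPrincipalIdealRing.principal I).principal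
  have haI : a ∈ Ideal.span {a} := Ideal.mem_span_singleton_self a
  obtain ⟨c, hc⟩ : ∃ c, g ⟨a, haI⟩ = a * c := by
    rcases eq_or_ne a 0 with rfl | ha
    · exact ⟨0, by rw [zero_mul]; exact map_zero g⟩
    obtain ⟨i, hi, u, hu⟩ := Trunc.exists_eq_t_pow_mul_unit ha
    have h0 : Trunc.t K p ^ (p - i) * a = 0 := by
      rw [Trunc.t_pow_mul_eq_zero (i := i) (by omega), hu]
      exact dvd_mul_right _ _
    have h1 : Trunc.t K p ^ (p - i) * g ⟨a, haI⟩ = 0 := by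
      rw [← smul_eq_mul, ← map_smul]
      refine Eq.trans (congrArg g (Subtype.ext ?_)) (map_zero g)
      exact h0
    obtain ⟨c, hc⟩ := (Trunc.t_pow_mul_eq_zero (i := i) (by omega) _).mp h1
    exact ⟨↑u⁻¹ * c, by rw [hc, hu, mul_assoc, Units.mul_inv_cancel_left]⟩
  refine ⟨LinearMap.mulRight (Trunc K p) c, fun x hx => ?_⟩
  obtain ⟨y, rfl⟩ := Ideal.mem_span_singleton'.mp hx
  have : (⟨y * a, hx⟩ : Ideal.span {a}) = y • ⟨a, haI⟩ := rfl
  rw [this, map_smul, hc, LinearMap.mulRight_apply, smul_eq_mul, mul_assoc]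

theorem Trunc.exists_equiv_of_projective [NeZero p] (F : Type*) [AddCommGroup F]
    [Module (Trunc K p) F] [Module.Finite (Trunc K p) F] [Module.Projective (Trunc K p) F] :
    ∃ n : ℕ, Nonempty (F ≃ₗ[Trunc K p] (Fin n → Trunc K p)) := by
  have : Module.Free (Trunc K p) F := Module.free_of_flat_of_isLocalRing
  exact ⟨_, ⟨(Module.finBasis (Trunc K p) F).equivFun⟩⟩

theorem Trunc.injective_of_projective [NeZero p] (F : Type u) [AddCommGroup F]
    [Module (Trunc K p) F] (_ : Module.Finite (Trunc K p) F)
    (_ : Module.Projective (Trunc K p) F) : Module.Injective (Trunc K p) F := by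
  obtain ⟨n, ⟨e⟩⟩ := Trunc.exists_equiv_of_projective (K := K) (p := p) F
  have := Trunc.injective_self (K := K) (p := p)
  have : Module.Injective (Trunc K p) (Fin n → Trunc K p) := Module.Injective.pi _ _
  exact Module.Baer.injective (Module.Baer.of_equiv e.symm (Module.Baer.of_injective this))

variable (K) in
/-- The embedding `[i] → K[t]/t^p`, `a ↦ t^j a`, for `i + j = p`. -/
noncomputable def JordanBlock.incl {i j : ℕ} (hij : i + j = p) :
    JordanBlock K p i →ₗ[Trunc K p] Trunc K p :=
  Submodule.liftQ _ (LinearMap.mulLeft (Trunc K p) (Trunc.t K p ^ j)) (fun a ha => by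
    rw [Ideal.mem_span_singleton] at ha
    exact (Trunc.t_pow_mul_eq_zero hij a).mpr ha)

variable (K p) in
/-- The projection `K[t]/t^p → [i]`. -/
noncomputable def JordanBlock.proj (i : ℕ) : Trunc K p →ₗ[Trunc K p] JordanBlock K p i :=
  Submodule.mkQ _

theorem JordanBlock.proj_eq_zero (i : ℕ) (a : Trunc K p) :
    JordanBlock.proj K p i a = 0 ↔ Trunc.t K p ^ i ∣ a :=
  (Submodule.Quotient.mk_eq_zero _).trans Ideal.mem_span_singleton

theorem JordanBlock.proj_surjective (i : ℕ) : Function.Surjective (JordanBlock.proj K p i) :=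
  Submodule.mkQ_surjective _

theorem JordanBlock.incl_proj {i j : ℕ} (hij : i + j = p) (a : Trunc K p) :
    JordanBlock.incl K hij (JordanBlock.proj K p i a) = Trunc.t K p ^ j * a := rfl

theorem JordanBlock.incl_injective {i j : ℕ} (hij : i + j = p) :
    Function.Injective (JordanBlock.incl K hij) := by
  rw [injective_iff_map_eq_zero]
  intro a ha
  obtain ⟨a, rfl⟩ := JordanBlock.proj_surjective _ a
  rw [JordanBlock.incl_proj, Trunc.t_pow_mul_eq_zero hij] at ha
  exact (JordanBlock.proj_eq_zero _ _).mpr ha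

/-- The short exact sequence `0 → [i] → K[t]/t^p → [j] → 0`, for `i + j = p`. -/
theorem JordanBlock.exact {i j : ℕ} (hij : i + j = p) :
    Function.Exact (JordanBlock.incl K hij) (JordanBlock.proj K p j) := fun a => by
  rw [JordanBlock.proj_eq_zero]
  constructor
  · rintro ⟨b, rfl⟩
    exact ⟨JordanBlock.proj K p i b, rfl⟩
  · rintro ⟨b, rfl⟩
    obtain ⟨b, rfl⟩ := JordanBlock.proj_surjective _ b
    exact ⟨b, rfl⟩

theorem JordanBlock.t_smul_one (x : JordanBlock K p 1) : Trunc.t K p • x = 0 := by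
  obtain ⟨a, rfl⟩ := JordanBlock.proj_surjective _ x
  rw [← map_smul, JordanBlock.proj_eq_zero, pow_one]
  exact dvd_mul_right _ _

end Trunc

/-! ### Modules with blocks of size `1` and `p` only -/

section Blocks

variable {K : Type u} [Field K] {p : ℕ}

theorem JordanBlock.finrank_one [NeZero p] : Module.finrank K (JordanBlock K p 1) = 1 := by
  refine finrank_eq_one (JordanBlock.proj K p 1 1) ?_ fun w => ?_
  · rw [Ne, JordanBlock.proj_eq_zero, pow_one]
    exact fun h => Trunc.not_isUnit_of_t_dvd h isUnit_one
  · obtain ⟨a, rfl⟩ := JordanBlock.proj_surjective _ w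
    obtain ⟨f, rfl⟩ := Trunc.mk_surjective a
    refine ⟨f.coeff 0, ?_⟩
    rw [← LinearMap.map_smul_of_tower, ← sub_eq_zero, ← map_sub, JordanBlock.proj_eq_zero, pow_one]
    refine ⟨Ideal.Quotient.mk _ (-f.divX), ?_⟩
    have h : f.coeff 0 • (1 : Trunc K p) = Ideal.Quotient.mk _ (Polynomial.C (f.coeff 0)) := by
      rw [← Algebra.algebraMap_eq_smul_one]; rfl
    have h' : Trunc.t K p = Ideal.Quotient.mk _ Polynomial.X := rfl
    rw [h, h', ← map_mul, ← map_sub]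
    congr 1
    linear_combination Polynomial.X_mul_divX_add f

theorem finrank_pi_of_finrank_eq_one {S : Type*} [AddCommGroup S] [Module K S]
    (h : Module.finrank K S = 1) (a : ℕ) : Module.finrank K (Fin a → S) = a := by
  have : Module.Finite K S := Module.finite_of_finrank_eq_succ h
  rw [Module.finrank_pi_fintype]
  simp [h]

variable (K p) in
/-- The `K[t]/t^p`-module `W` has only Jordan blocks of sizes `1` and `p`: a generator of a block
of size `1 < i < p` would be killed by `t^{p-1}`, while `t` times it would not lie in `t² W`. -/
def OnlyExtremeBlocks (W : Type*) [AddCommGroup W] [Module (Trunc K p) W] : Prop :=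
  ∀ w : W, Trunc.t K p ^ (p - 1) • w = 0 → ∃ w' : W, Trunc.t K p • w = Trunc.t K p ^ 2 • w'

namespace OnlyExtremeBlocks

theorem self [NeZero p] : OnlyExtremeBlocks K p (Trunc K p) := fun a ha => by
  have hp := NeZero.pos p
  obtain ⟨b, rfl⟩ := (Trunc.t_pow_mul_eq_zero (i := 1) (j := p - 1) (by omega) a).mp ha
  exact ⟨b, by simp only [smul_eq_mul]; ring⟩

theorem jordanBlock_one : OnlyExtremeBlocks K p (JordanBlock K p 1) := fun w _ =>
  ⟨0, by rw [JordanBlock.t_smul_one, smul_zero]⟩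

theorem prod {W W' : Type*} [AddCommGroup W] [Module (Trunc K p) W] [AddCommGroup W']
    [Module (Trunc K p) W'] (h : OnlyExtremeBlocks K p W) (h' : OnlyExtremeBlocks K p W') :
    OnlyExtremeBlocks K p (W × W') := fun w hw => by
  obtain ⟨a, ha⟩ := h w.1 (congrArg Prod.fst hw)
  obtain ⟨b, hb⟩ := h' w.2 (congrArg Prod.snd hw)
  exact ⟨(a, b), Prod.ext ha hb⟩

theorem pi {ι : Type*} {W : ι → Type*} [∀ i, AddCommGroup (W i)] [∀ i, Module (Trunc K p) (W i)]
    (h : ∀ i, OnlyExtremeBlocks K p (W i)) : OnlyExtremeBlocks K p (∀ i, W i) := fun w hw => by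
  choose a ha using fun i => h i (w i) (congrFun hw i)
  exact ⟨a, funext ha⟩

theorem of_retract {W W' : Type*} [AddCommGroup W] [Module (Trunc K p) W] [AddCommGroup W']
    [Module (Trunc K p) W'] (i : W →ₗ[Trunc K p] W') (r : W' →ₗ[Trunc K p] W)
    (hr : ∀ w, r (i w) = w) (h : OnlyExtremeBlocks K p W') : OnlyExtremeBlocks K p W :=
  fun w hw => by
    obtain ⟨a, ha⟩ := h (i w) (by rw [← map_smul, hw, map_zero])
    exact ⟨r a, by rw [← map_smul, ← ha, map_smul, hr]⟩

end OnlyExtremeBlocks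

theorem nonempty_equiv_pi_jordanBlock_one [NeZero p] (W : Type*) [AddCommGroup W] [Module K W]
    [Module (Trunc K p) W] [IsScalarTower K (Trunc K p) W] [Module.Finite K W]
    (hW : ∀ w : W, Trunc.t K p • w = 0) :
    Nonempty (W ≃ₗ[Trunc K p] (Fin (Module.finrank K W) → JordanBlock K p 1)) := by
  let b := Module.finBasis K W
  let g : W → JordanBlock K p 1 →ₗ[Trunc K p] W := fun w =>
    Submodule.liftQ _ (LinearMap.toSpanSingleton (Trunc K p) W w) (fun x hx => by
      obtain ⟨y, rfl⟩ := Ideal.mem_span_singleton'.mp hx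
      rw [LinearMap.mem_ker, LinearMap.toSpanSingleton_apply, pow_one, mul_smul, hW, smul_zero])
  have hg : ∀ w, g w (JordanBlock.proj K p 1 1) = w := fun w => one_smul (Trunc K p) w
  let Φ : (Fin (Module.finrank K W) → JordanBlock K p 1) →ₗ[Trunc K p] W :=
    ∑ i, g (b i) ∘ₗ LinearMap.proj i
  have hsurj : Function.Surjective (Φ.restrictScalars K) := by
    rw [← LinearMap.range_eq_top, eq_top_iff, ← b.span_eq, Submodule.span_le]
    rintro _ ⟨i, rfl⟩
    refine ⟨Pi.single i (JordanBlock.proj K p 1 1), ?_⟩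
    change Φ _ = _
    rw [LinearMap.sum_apply, Finset.sum_eq_single i]
    · simp [hg]
    · intro j _ hj
      simp [Pi.single_eq_of_ne hj]
    · simp
  have hinj := (LinearMap.injective_iff_surjective_of_finrank_eq_finrank
    (f := Φ.restrictScalars K) (finrank_pi_of_finrank_eq_one JordanBlock.finrank_one _)).mpr hsurj
  exact ⟨(LinearEquiv.ofBijective Φ ⟨hinj, hsurj⟩).symm⟩

/-- Adding one more copy of `N` to `M × Nᵇ`. -/
def prodPiSuccEquiv (A M N : Type*) [Ring A] [AddCommGroup M] [Module A M] [AddCommGroup N]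
    [Module A N] (b : ℕ) : (N × M × (Fin b → N)) ≃ₗ[A] M × (Fin (b + 1) → N) :=
  (LinearEquiv.prodAssoc A N M (Fin b → N)).symm.trans <|
    (LinearEquiv.prodCongr (LinearEquiv.prodComm A N M) (LinearEquiv.refl A (Fin b → N))).trans <|
      (LinearEquiv.prodAssoc A M N (Fin b → N)).trans <|
        LinearEquiv.prodCongr (LinearEquiv.refl A M) (Fin.consLinearEquiv A fun _ => N)

/-- `M^(a+b) ≃ M^a × M^b`. -/
def piAddEquiv (A M : Type*) [Ring A] [AddCommGroup M] [Module A M] (a b : ℕ) :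
    (Fin (a + b) → M) ≃ₗ[A] (Fin a → M) × (Fin b → M) :=
  (LinearEquiv.funCongrLeft A M finSumFinEquiv).trans
    (LinearEquiv.sumArrowLequivProdArrow (Fin a) (Fin b) A M)

/-- An element not killed by `t^{p-1}` generates a free direct summand. -/
theorem exists_equiv_trunc_prod [NeZero p] (W : Type u) [AddCommGroup W]
    [Module (Trunc K p) W] {w : W} (hw : Trunc.t K p ^ (p - 1) • w ≠ 0) :
    Nonempty (W ≃ₗ[Trunc K p] Trunc K p ×
      (W ⧸ LinearMap.range (LinearMap.toSpanSingleton (Trunc K p) W w))) := by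
  have := Trunc.injective_self (K := K) (p := p)
  refine nonempty_equiv_prod_of_injective (f := LinearMap.toSpanSingleton (Trunc K p) W w)
    (g := Submodule.mkQ _) ?_ (LinearMap.exact_map_mkQ_range _) (Submodule.mkQ_surjective _)
  rw [injective_iff_map_eq_zero]
  intro a ha
  by_contra h
  obtain ⟨i, hi, u, rfl⟩ := Trunc.exists_eq_t_pow_mul_unit h
  apply hw
  have e : Trunc.t K p ^ (p - 1) = (↑u⁻¹ * Trunc.t K p ^ (p - 1 - i)) * (Trunc.t K p ^ i * u) := by
    rw [mul_comm _ (u : Trunc K p), mul_mul_mul_comm, Units.inv_mul, one_mul, ← pow_add]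
    congr 1
    omega
  rw [e, mul_smul]
  exact (congrArg _ ha).trans (smul_zero _)

/-- A finite-dimensional `K[t]/t^p`-module all of whose Jordan blocks have size `1` or `p` is a
direct sum of such blocks. -/
theorem OnlyExtremeBlocks.exists_equiv [NeZero p] (W : Type u) [AddCommGroup W] [Module K W]
    [Module (Trunc K p) W] [IsScalarTower K (Trunc K p) W] [Module.Finite K W]
    (h : OnlyExtremeBlocks K p W) :
    ∃ a b : ℕ, Nonempty (W ≃ₗ[Trunc K p] (Fin a → JordanBlock K p 1) × (Fin b → Trunc K p)) := by
  induction hn : Module.finrank K W using Nat.strong_induction_on generalizing W with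
  | _ n ih =>
  by_cases h0 : ∀ w : W, Trunc.t K p ^ (p - 1) • w = 0
  -- if `t^{p-1} W = 0`, then `t W = t² W = ⋯ = t^p W = 0`
  · have hdvd : ∀ (i : ℕ) (w : W), ∃ w' : W, Trunc.t K p • w = Trunc.t K p ^ (i + 1) • w' := by
      intro i
      induction i with
      | zero => exact fun w => ⟨w, by simp⟩
      | succ i hi =>
        intro w
        obtain ⟨w₁, hw₁⟩ := h w (h0 w)
        obtain ⟨w₂, hw₂⟩ := hi w₁
        exact ⟨w₂, by rw [hw₁, pow_two, mul_smul, hw₂, ← mul_smul, ← pow_succ']⟩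
    have ht : ∀ w : W, Trunc.t K p • w = 0 := fun w => by
      obtain ⟨w', hw'⟩ := hdvd (p - 1) w
      rw [hw', Nat.sub_add_cancel (NeZero.pos p), Trunc.t_pow_self]
      exact zero_smul (Trunc K p) w'
    obtain ⟨e⟩ := nonempty_equiv_pi_jordanBlock_one W ht
    exact ⟨_, 0, ⟨e.trans (LinearEquiv.prodUnique (R := Trunc K p)).symm⟩⟩
  · push Not at h0
    obtain ⟨w, hw⟩ := h0
    obtain ⟨e⟩ := exists_equiv_trunc_prod W hw
    set W' := W ⧸ LinearMap.range (LinearMap.toSpanSingleton (Trunc K p) W w)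
    have hfin : n = p + Module.finrank K W' := by
      rw [← hn, (e.restrictScalars K).finrank_eq, Module.finrank_prod, Trunc.finrank]
    obtain ⟨a, b, ⟨e'⟩⟩ := ih (Module.finrank K W') (by have := NeZero.pos p; omega) W'
      (OnlyExtremeBlocks.of_retract (W := W') (W' := W)
        (e.symm.toLinearMap ∘ₗ LinearMap.inr (Trunc K p) (Trunc K p) W')
        (LinearMap.snd (Trunc K p) (Trunc K p) W' ∘ₗ e.toLinearMap) (fun x => by simp) h) rfl
    have e'' : W ≃ₗ[Trunc K p] Trunc K p × (Fin a → JordanBlock K p 1) × (Fin b → Trunc K p) :=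
      e.trans (LinearEquiv.prodCongr (LinearEquiv.refl (Trunc K p) (Trunc K p)) e')
    exact ⟨a, b + 1, ⟨e''.trans (prodPiSuccEquiv (Trunc K p) _ _ b)⟩⟩

section Count

variable {S : Type*} [AddCommGroup S] [Module (Trunc K p) S]

/-- If `S` is the kernel of `t` on `K[t]/t^p`, then the kernel of `t` on `Sᵃ ⊕ [p]^b` is
`Sᵃ ⊕ Sᵇ`. -/
theorem nonempty_equiv_ker_t {incl : S →ₗ[Trunc K p] Trunc K p}
    (hinj : Function.Injective incl) (hS : ∀ s : S, Trunc.t K p • s = 0)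
    (hrange : ∀ x : Trunc K p, Trunc.t K p • x = 0 → ∃ z, incl z = x) (a b : ℕ) :
    Nonempty (((Fin a → S) × (Fin b → S)) ≃ₗ[Trunc K p]
      LinearMap.ker (LinearMap.lsmul (Trunc K p)
        ((Fin a → S) × (Fin b → Trunc K p)) (Trunc.t K p))) := by
  let j : ((Fin a → S) × (Fin b → S)) →ₗ[Trunc K p] (Fin a → S) × (Fin b → Trunc K p) :=
    LinearMap.prodMap LinearMap.id (incl.compLeft (Fin b))
  have hj : Function.Injective j :=
    Function.Injective.prodMap Function.injective_id fun x y hxy =>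
      funext fun i => hinj (congrFun hxy i)
  have hker : ∀ x, j x ∈ LinearMap.ker (LinearMap.lsmul (Trunc K p)
      ((Fin a → S) × (Fin b → Trunc K p)) (Trunc.t K p)) := fun x => by
    rw [LinearMap.mem_ker, LinearMap.lsmul_apply, ← map_smul]
    exact (congrArg j (Prod.ext (funext fun i => hS _) (funext fun i => hS _))).trans (map_zero j)
  refine ⟨LinearEquiv.ofBijective (j.codRestrict _ hker) ⟨fun x y hxy =>
    hj (congrArg Subtype.val hxy), ?_⟩⟩
  rintro ⟨⟨x, y⟩, h⟩
  have h : Trunc.t K p • (x, y) = 0 := h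
  choose z hz using fun i => hrange (y i) (congrFun (congrArg Prod.snd h) i)
  exact ⟨(x, z), Subtype.ext (Prod.ext rfl (funext hz))⟩

theorem finrank_eq_of_equiv [Module K S] [IsScalarTower K (Trunc K p) S] (h1 : Module.finrank K S = 1)
    {W : Type*} [AddCommGroup W]
    [Module K W] [Module (Trunc K p) W] [IsScalarTower K (Trunc K p) W] {a b : ℕ}
    (e : W ≃ₗ[Trunc K p] (Fin a → S) × (Fin b → Trunc K p)) : Module.finrank K W = a + b * p := by
  have : Module.Finite K S := Module.finite_of_finrank_eq_succ h1
  rw [(e.restrictScalars K).finrank_eq, Module.finrank_prod, finrank_pi_of_finrank_eq_one h1,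
    Module.finrank_pi_fintype]
  simp only [Trunc.finrank, Finset.sum_const, Finset.card_univ, Fintype.card_fin, smul_eq_mul]

/-- For a one-dimensional `S`, the number of summands `S` is determined by the dimensions of the
module and of the kernel of `t`. -/
theorem card_eq_of_equiv [Module K S] [IsScalarTower K (Trunc K p) S]
    {incl : S →ₗ[Trunc K p] Trunc K p}
    (hinj : Function.Injective incl) (hS : ∀ s : S, Trunc.t K p • s = 0)
    (hrange : ∀ x : Trunc K p, Trunc.t K p • x = 0 → ∃ z, incl z = x)
    (h1 : Module.finrank K S = 1) (hp : 2 ≤ p) {a b a' b' : ℕ}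
    (e : ((Fin a → S) × (Fin b → Trunc K p)) ≃ₗ[Trunc K p]
      (Fin a' → S) × (Fin b' → Trunc K p)) : a = a' := by
  have : Module.Finite K S := Module.finite_of_finrank_eq_succ h1
  have hdim : a + b * p = a' + b' * p :=
    (finrank_eq_of_equiv h1 (LinearEquiv.refl _ _)).symm.trans (finrank_eq_of_equiv h1 e)
  obtain ⟨e₁⟩ := nonempty_equiv_ker_t hinj hS hrange a b
  obtain ⟨e₂⟩ := nonempty_equiv_ker_t hinj hS hrange a' b'
  have hmap : (LinearMap.ker (LinearMap.lsmul (Trunc K p) _ (Trunc.t K p))).map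
      e.toLinearMap = LinearMap.ker (LinearMap.lsmul (Trunc K p) _ (Trunc.t K p)) := by
    ext y
    rw [Submodule.mem_map_equiv, LinearMap.mem_ker, LinearMap.mem_ker, LinearMap.lsmul_apply,
      LinearMap.lsmul_apply, ← map_smul, LinearEquiv.map_eq_zero_iff]
  have hker : a + b = a' + b' := by
    have := ((e₁.trans ((e.submoduleMap _).trans
      ((LinearEquiv.ofEq _ _ hmap).trans e₂.symm))).restrictScalars K).finrank_eq
    rwa [Module.finrank_prod, Module.finrank_prod, finrank_pi_of_finrank_eq_one h1,
      finrank_pi_of_finrank_eq_one h1, finrank_pi_of_finrank_eq_one h1,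
      finrank_pi_of_finrank_eq_one h1] at this
  rcases lt_trichotomy b b' with h | h | h <;> nlinarith

end Count

/-- The number of Jordan blocks of size `1` is an isomorphism invariant: both the dimension and the
dimension of the kernel of `t` are. -/
theorem card_jordanBlock_one_eq (hp : 2 ≤ p) {a b a' b' : ℕ}
    (e : ((Fin a → JordanBlock K p 1) × (Fin b → Trunc K p)) ≃ₗ[Trunc K p]
      (Fin a' → JordanBlock K p 1) × (Fin b' → Trunc K p)) : a = a' := by
  have : NeZero p := ⟨by omega⟩
  have hp1 : 1 + (p - 1) = p := by omega
  refine card_eq_of_equiv (JordanBlock.incl_injective hp1) JordanBlock.t_smul_one (fun x hx => ?_)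
    JordanBlock.finrank_one hp e
  refine (JordanBlock.exact hp1 x).mp ((JordanBlock.proj_eq_zero _ _).mpr ?_)
  rwa [← Trunc.t_pow_mul_eq_zero (j := 1) (by omega), pow_one]

/-- A module that becomes `[1]^m ⊕ (free)` after adding `[1]^n ⊕ (free)` is `[1]^{m-n} ⊕ (free)`. -/
theorem exists_equiv_of_prod_equiv (hp : 2 ≤ p) (W : Type u) [AddCommGroup W] [Module K W]
    [Module (Trunc K p) W] [IsScalarTower K (Trunc K p) W] [Module.Finite K W] {m n f f' : ℕ}
    (e : (W × (Fin n → JordanBlock K p 1) × (Fin f → Trunc K p)) ≃ₗ[Trunc K p]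
      (Fin m → JordanBlock K p 1) × (Fin f' → Trunc K p)) :
    ∃ b : ℕ, Nonempty (W ≃ₗ[Trunc K p]
      (Fin (m - n) → JordanBlock K p 1) × (Fin b → Trunc K p)) := by
  have : NeZero p := ⟨by omega⟩
  have hW : OnlyExtremeBlocks K p W :=
    OnlyExtremeBlocks.of_retract (e.toLinearMap ∘ₗ LinearMap.inl _ _ _)
      (LinearMap.fst _ _ _ ∘ₗ e.symm.toLinearMap) (fun x => by simp)
      (.prod (.pi fun _ => .jordanBlock_one) (.pi fun _ => .self))
  obtain ⟨a, b, ⟨e'⟩⟩ := hW.exists_equiv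
  have := card_jordanBlock_one_eq hp (a := a + n) (b := b + f) (a' := m) (b' := f')
    (LinearEquiv.trans (LinearEquiv.prodCongr
      (piAddEquiv _ _ _ _) (piAddEquiv _ _ _ _)) <|
      LinearEquiv.trans (LinearEquiv.prodProdProdComm _ _ _ _ _) <|
      LinearEquiv.trans (LinearEquiv.prodCongr e'.symm (LinearEquiv.refl _ _)) e)
  obtain rfl : a = m - n := by omega
  exact ⟨b, ⟨e'⟩⟩

theorem hasJordanType_of_equiv (hp : 2 ≤ p) (W : Type u) [AddCommGroup W]
    [Module (Trunc K p) W] (a : ℕ → ℕ) (ha : ∀ i, i ≠ 1 → i ≠ p → a i = 0)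
    (e : W ≃ₗ[Trunc K p] (Fin (a 1) → JordanBlock K p 1) × (Fin (a p) → Trunc K p)) :
    HasJordanType K p a W := by
  have h1 : 1 ∈ Finset.Icc 1 p := by simp; omega
  have h2 : p ∈ Finset.Icc 1 p := by simp; omega
  let g : ((i : Finset.Icc 1 p) → Fin (a i) → JordanBlock K p i) →ₗ[Trunc K p]
      (Fin (a 1) → JordanBlock K p 1) × (Fin (a p) → JordanBlock K p p) :=
    LinearMap.prod (LinearMap.proj (φ := fun i : Finset.Icc 1 p => Fin (a i) → JordanBlock K p i)
      ⟨1, h1⟩) (LinearMap.proj (φ := fun i : Finset.Icc 1 p => Fin (a i) → JordanBlock K p i)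
      ⟨p, h2⟩)
  have hg : Function.Bijective g := by
    constructor
    · intro x y hxy
      ext i j
      by_cases hi : (i : ℕ) = 1
      · obtain rfl : i = ⟨1, h1⟩ := Subtype.ext hi
        exact congrFun (congrArg Prod.fst hxy) j
      by_cases hi' : (i : ℕ) = p
      · obtain rfl : i = ⟨p, h2⟩ := Subtype.ext hi'
        exact congrFun (congrArg Prod.snd hxy) j
      · exact absurd j.pos (by simp [ha i hi hi'])
    · rintro ⟨x, y⟩
      have hne : (⟨1, h1⟩ : Finset.Icc 1 p) ≠ ⟨p, h2⟩ := fun h => by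
        have := congrArg Subtype.val h
        dsimp only at this
        omega
      exact ⟨Function.update (Function.update 0 ⟨1, h1⟩ x) ⟨p, h2⟩ y, Prod.ext
        ((Function.update_of_ne hne _ _).trans (Function.update_self _ _ _))
        (Function.update_self _ _ _)⟩
  have hbij : Function.Bijective (JordanBlock.proj K p p) :=
    ⟨(injective_iff_map_eq_zero _).mpr fun x hx => by
      rwa [JordanBlock.proj_eq_zero, Trunc.t_pow_self, zero_dvd_iff] at hx,
      JordanBlock.proj_surjective _⟩
  refine ⟨e.trans ((LinearEquiv.prodCongr (LinearEquiv.refl _ _)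
    (LinearEquiv.piCongrRight fun _ => LinearEquiv.ofBijective _ hbij)).trans
      (LinearEquiv.ofBijective g hg).symm)⟩

end Blocks

/-! ### Restriction along a π-point -/

section ScalarStructure

variable {k R : Type u} [Field k] [CommRing R] [HopfAlgebra k R]

/-- The `k`-vector space underlying a `kG`-module. -/
noncomputable abbrev baseModule (V : Type u) [AddCommGroup V] [Module (GroupAlgebra k R) V] :
    Module k V :=
  Module.compHom V (algebraMap k (GroupAlgebra k R))

theorem baseModule_isScalarTower (V : Type u) [AddCommGroup V] [Module (GroupAlgebra k R) V] :
    @IsScalarTower k (GroupAlgebra k R) V _ _ (baseModule (k := k) (R := R) V).toSMul :=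
  let _ := baseModule (k := k) (R := R) V
  ⟨fun c a x => by rw [Algebra.smul_def, mul_smul]; rfl⟩

instance [Module.Finite k R] : Module.Finite k (GroupAlgebra k R) :=
  Module.Finite.equiv (WithConv.linearEquiv k (R →ₗ[k] k)).symm

instance [Module.Finite k R] : IsNoetherianRing (GroupAlgebra k R) :=
  IsNoetherianRing.of_finite k _

instance : Module k (Trivial k R) := inferInstanceAs (Module k k)

instance : IsScalarTower k (GroupAlgebra k R) (Trivial k R) :=
  ⟨fun c f x => mul_assoc (c : k) (f.ofConv 1) x⟩

instance : Module.Finite k (Trivial k R) := inferInstanceAs (Module.Finite k k)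

theorem Trivial.finrank : Module.finrank k (Trivial k R) = 1 := Module.finrank_self k

end ScalarStructure

section Restrict

variable {k R : Type u} [Field k] [CommRing R] [HopfAlgebra k R]
  {K : Type u} [Field K] [Algebra k K] {p : ℕ}
  (α : Trunc K p →ₐ[K] K ⊗[k] GroupAlgebra k R)
  {V W U : Type u} [AddCommGroup V] [Module k V] [Module (GroupAlgebra k R) V]
  [IsScalarTower k (GroupAlgebra k R) V]
  [AddCommGroup W] [Module k W] [Module (GroupAlgebra k R) W]
  [IsScalarTower k (GroupAlgebra k R) W]
  [AddCommGroup U] [Module k U] [Module (GroupAlgebra k R) U]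
  [IsScalarTower k (GroupAlgebra k R) U]

instance : Module K (Restrict α V) := inferInstanceAs (Module K (K ⊗[k] V))

theorem Restrict.smul_def (x : Trunc K p) (v : Restrict α V) :
    x • v = (baseChangeAction k R K V (α x) v : K ⊗[k] V) := rfl

instance : IsScalarTower K (Trunc K p) (Restrict α V) := ⟨fun c x v => by
  rw [Restrict.smul_def, Restrict.smul_def, map_smul, map_smul]; rfl⟩

instance [Module.Finite k V] : Module.Finite K (Restrict α V) :=
  inferInstanceAs (Module.Finite K (K ⊗[k] V))

omit [Module (GroupAlgebra k R) V] [IsScalarTower k (GroupAlgebra k R) V] in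
theorem Restrict.finrank : Module.finrank K (Restrict α V) = Module.finrank k V :=
  Module.finrank_baseChange (R := K) (S := k) (M' := V)

theorem restrictHom_id : restrictHom α (LinearMap.id : V →ₗ[GroupAlgebra k R] V) = LinearMap.id :=
  LinearMap.ext fun v => LinearMap.congr_fun (LinearMap.baseChange_id (A := K)) v

theorem restrictHom_comp (g : W →ₗ[GroupAlgebra k R] U) (f : V →ₗ[GroupAlgebra k R] W) :
    restrictHom α (g ∘ₗ f) = restrictHom α g ∘ₗ restrictHom α f :=
  LinearMap.ext fun v => LinearMap.congr_fun
    (LinearMap.baseChange_comp (A := K) (f.restrictScalars k) (g.restrictScalars k)) v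

theorem restrictHom_add (f g : V →ₗ[GroupAlgebra k R] W) :
    restrictHom α (f + g) = restrictHom α f + restrictHom α g :=
  LinearMap.ext fun v => LinearMap.congr_fun
    (LinearMap.baseChange_add (A := K) (f.restrictScalars k) (g.restrictScalars k)) v

theorem restrictHom_zero : restrictHom α (0 : V →ₗ[GroupAlgebra k R] W) = 0 :=
  LinearMap.ext fun v => LinearMap.congr_fun (LinearMap.baseChange_zero (A := K)) v

theorem restrictHom_sum {ι : Type*} (s : Finset ι) (f : ι → V →ₗ[GroupAlgebra k R] W) :
    restrictHom α (∑ i ∈ s, f i) = ∑ i ∈ s, restrictHom α (f i) := by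
  classical
  induction s using Finset.induction_on with
  | empty => simp [restrictHom_zero]
  | insert a s ha ih => rw [Finset.sum_insert ha, Finset.sum_insert ha, restrictHom_add, ih]

/-- Restriction along `α` of an isomorphism. -/
noncomputable def restrictEquiv (e : V ≃ₗ[GroupAlgebra k R] W) :
    Restrict α V ≃ₗ[Trunc K p] Restrict α W :=
  LinearEquiv.ofLinearMap (restrictHom α e.toLinearMap) (restrictHom α e.symm.toLinearMap)
    (by rw [← restrictHom_comp, LinearEquiv.comp_symm, restrictHom_id])
    (by rw [← restrictHom_comp, LinearEquiv.symm_comp, restrictHom_id])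

theorem restrictHom_injective {f : V →ₗ[GroupAlgebra k R] W} (hf : Function.Injective f) :
    Function.Injective (restrictHom α f) :=
  Module.Flat.lTensor_preserves_injective_linearMap (M := K) (f.restrictScalars k) hf

theorem restrictHom_surjective {f : V →ₗ[GroupAlgebra k R] W} (hf : Function.Surjective f) :
    Function.Surjective (restrictHom α f) :=
  LinearMap.lTensor_surjective K (g := f.restrictScalars k) hf

theorem restrictHom_exact {f : V →ₗ[GroupAlgebra k R] W} {g : W →ₗ[GroupAlgebra k R] U}
    (h : Function.Exact f g) : Function.Exact (restrictHom α f) (restrictHom α g) :=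
  Module.Flat.lTensor_exact K (f := f.restrictScalars k) (g := g.restrictScalars k) h

variable (V W) in
/-- Restriction along `α` commutes with binary direct sums. -/
noncomputable def restrictProd : Restrict α (V × W) ≃ₗ[Trunc K p] Restrict α V × Restrict α W :=
  LinearEquiv.ofLinearMap
    (LinearMap.prod (restrictHom α (LinearMap.fst (GroupAlgebra k R) V W))
      (restrictHom α (LinearMap.snd (GroupAlgebra k R) V W)))
    (LinearMap.coprod (restrictHom α (LinearMap.inl (GroupAlgebra k R) V W))
      (restrictHom α (LinearMap.inr (GroupAlgebra k R) V W)))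
    (by
      refine LinearMap.prod_ext ?_ ?_
      · rw [LinearMap.comp_assoc, LinearMap.coprod_inl, LinearMap.prod_comp, ← restrictHom_comp,
          ← restrictHom_comp, LinearMap.fst_comp_inl, LinearMap.snd_comp_inl, restrictHom_id,
          restrictHom_zero]
        rfl
      · rw [LinearMap.comp_assoc, LinearMap.coprod_inr, LinearMap.prod_comp, ← restrictHom_comp,
          ← restrictHom_comp, LinearMap.fst_comp_inr, LinearMap.snd_comp_inr, restrictHom_id,
          restrictHom_zero]
        rfl)
    (by
      rw [LinearMap.coprod_comp_prod, ← restrictHom_comp, ← restrictHom_comp, ← restrictHom_add,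
        ← LinearMap.coprod_comp_prod, LinearMap.coprod_inl_inr, LinearMap.pair_fst_snd,
        LinearMap.id_comp, restrictHom_id])

/-- Restriction along `α` commutes with finite direct sums. -/
noncomputable def restrictPi {m : ℕ} (X : Fin m → Type u) [∀ j, AddCommGroup (X j)]
    [∀ j, Module k (X j)] [∀ j, Module (GroupAlgebra k R) (X j)]
    [∀ j, IsScalarTower k (GroupAlgebra k R) (X j)] :
    Restrict α (∀ j, X j) ≃ₗ[Trunc K p] ∀ j, Restrict α (X j) :=
  LinearEquiv.ofLinearMap
    (LinearMap.pi fun j => restrictHom α (LinearMap.proj (R := GroupAlgebra k R) j))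
    (∑ j, restrictHom α (LinearMap.single (GroupAlgebra k R) X j) ∘ₗ LinearMap.proj j)
    (by
      refine LinearMap.ext fun x => funext fun i => ?_
      simp only [LinearMap.comp_apply, LinearMap.pi_apply, LinearMap.sum_apply,
        LinearMap.proj_apply, LinearMap.id_apply, map_sum]
      rw [Finset.sum_eq_single i]
      · rw [← LinearMap.comp_apply, ← restrictHom_comp, LinearMap.proj_comp_single_same,
          restrictHom_id, LinearMap.id_apply]
      · intro j _ hj
        rw [← LinearMap.comp_apply, ← restrictHom_comp,
          LinearMap.proj_comp_single_ne _ _ _ _ hj.symm, restrictHom_zero, LinearMap.zero_apply]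
      · exact fun h => absurd (Finset.mem_univ i) h)
    (by
      have h : ∀ j, (restrictHom α (LinearMap.single (GroupAlgebra k R) X j) ∘ₗ LinearMap.proj j) ∘ₗ
          (LinearMap.pi fun j => restrictHom α (LinearMap.proj (R := GroupAlgebra k R) j)) =
            restrictHom α (LinearMap.single (GroupAlgebra k R) X j ∘ₗ LinearMap.proj j) :=
        fun j => by rw [restrictHom_comp]; rfl
      have hsum : ∑ j, LinearMap.single (GroupAlgebra k R) X j ∘ₗ LinearMap.proj j =
          LinearMap.id := LinearMap.ext fun x => by
        rw [LinearMap.sum_apply]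
        exact Finset.univ_sum_single x
      refine LinearMap.ext fun x => ?_
      rw [LinearMap.comp_apply, LinearMap.sum_apply, ← restrictHom_id, ← hsum, restrictHom_sum,
        LinearMap.sum_apply]
      exact Finset.sum_congr rfl fun j _ => LinearMap.congr_fun (h j) x)

theorem baseChangeAction_self (x v : K ⊗[k] GroupAlgebra k R) :
    baseChangeAction k R K (GroupAlgebra k R) x v =
      Algebra.lmul K (K ⊗[k] GroupAlgebra k R) x v := by
  induction x with
  | zero => rw [map_zero, map_zero]
  | add x y hx hy => rw [map_add, map_add, LinearMap.add_apply, hx, hy, LinearMap.add_apply]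
  | tmul c g =>
    induction v with
    | zero => rw [map_zero, map_zero]
    | add x y hx hy => rw [map_add, hx, hy, map_add]
    | tmul d v =>
      rw [baseChangeAction_tmul]
      exact (Algebra.TensorProduct.tmul_mul_tmul c d g v).symm

variable {α}

/-- `KG` is projective over `K[t]/t^p`: it is flat by assumption, and finitely presented. -/
theorem IsPiPoint.projective_restrict_self [Module.Finite k R] (hα : IsPiPoint α) :
    Module.Projective (Trunc K p) (Restrict α (GroupAlgebra k R)) := by
  have hflat : Module.Flat (Trunc K p) (Restrict α (GroupAlgebra k R)) := by
    let _ : Module (Trunc K p) (K ⊗[k] GroupAlgebra k R) := Module.compHom _ α.toRingHom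
    have := hα.flat
    exact Module.Flat.of_linearEquiv
      { (LinearEquiv.refl K (K ⊗[k] GroupAlgebra k R)).toAddEquiv with
        map_smul' := fun x v => baseChangeAction_self (α x) v }
  have : Module.Finite (Trunc K p) (Restrict α (GroupAlgebra k R)) :=
    Module.Finite.of_restrictScalars_finite K _ _
  have : Module.FinitePresentation (Trunc K p) (Restrict α (GroupAlgebra k R)) :=
    Module.finitePresentation_of_finite _ _
  exact Module.Flat.projective_of_finitePresentation

/-- Restriction along a π-point preserves finitely generated projective modules. -/
theorem IsPiPoint.projective_restrict [Module.Finite k R] (hα : IsPiPoint α)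
    [Module.Finite (GroupAlgebra k R) V] [Module.Projective (GroupAlgebra k R) V] :
    Module.Projective (Trunc K p) (Restrict α V) := by
  obtain ⟨n, f, hf⟩ := Module.Finite.exists_fin' (GroupAlgebra k R) V
  obtain ⟨s, hs⟩ := Module.projective_lifting_property f LinearMap.id hf
  have := hα.projective_restrict_self
  have : Module.Projective (Trunc K p) (Fin n → Restrict α (GroupAlgebra k R)) := projective_pi
  have : Module.Projective (Trunc K p) (Restrict α (Fin n → GroupAlgebra k R)) :=
    Module.Projective.of_equiv (restrictPi α (fun _ : Fin n => GroupAlgebra k R)).symm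
  exact Module.Projective.of_split (restrictHom α s) (restrictHom α f)
    (by rw [← restrictHom_comp, hs, restrictHom_id])

theorem finite_restrict [Module.Finite k R] [Module.Finite (GroupAlgebra k R) V] :
    Module.Finite (Trunc K p) (Restrict α V) := by
  have : Module.Finite k V := Module.Finite.trans (GroupAlgebra k R) V
  exact Module.Finite.of_restrictScalars_finite K _ _

/-- The trivial module restricts to `[1]`: the nilpotent element `t` acts nilpotently, hence as
zero, on a one-dimensional space. -/
theorem nonempty_restrict_trivial_equiv [NeZero p] :
    Nonempty (Restrict α (Trivial k R) ≃ₗ[Trunc K p] JordanBlock K p 1) := by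
  have h1 : Module.finrank K (Restrict α (Trivial k R)) = 1 := by
    rw [Restrict.finrank, Trivial.finrank]
  obtain ⟨v, hv, hspan⟩ := finrank_eq_one_iff'.mp h1
  have := IsScalarTower.to_smulCommClass' (R := K) (A := Trunc K p)
    (M := Restrict α (Trivial k R))
  have ht : ∀ w : Restrict α (Trivial k R), Trunc.t K p • w = 0 := by
    obtain ⟨c, hc⟩ := hspan (Trunc.t K p • v)
    have hpow : ∀ i : ℕ, Trunc.t K p ^ i • v = c ^ i • v := by
      intro i
      induction i with
      | zero => simp
      | succ i ih => rw [pow_succ', mul_smul, ih, smul_comm, ← hc, ← mul_smul, ← pow_succ]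
    have hc0 : c = 0 := by
      have := hpow p
      rw [Trunc.t_pow_self] at this
      have := ((zero_smul (Trunc K p) v).symm.trans this).symm
      exact eq_zero_of_pow_eq_zero ((smul_eq_zero.mp this).resolve_right hv)
    intro w
    obtain ⟨d, rfl⟩ := hspan w
    rw [smul_comm, ← hc, hc0, zero_smul, smul_zero]
  obtain ⟨e⟩ := nonempty_equiv_pi_jordanBlock_one _ ht
  rw [h1] at e
  exact ⟨e.trans (LinearEquiv.funUnique (Fin 1) (Trunc K p) (JordanBlock K p 1))⟩

end Restrict

/-! ### Stable homomorphisms between modules of type `[1]` -/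

section StableMaps

variable {A : Type u} [Ring A] {V W U : Type u} [AddCommGroup V] [Module A V]
  [AddCommGroup W] [Module A W] [AddCommGroup U] [Module A U]

theorem comp_mem_projectiveMaps (g : W →ₗ[A] U) {f : V →ₗ[A] W} (hf : f ∈ projectiveMaps A V W) :
    g ∘ₗ f ∈ projectiveMaps A V U := by
  obtain ⟨P, _, _, a, b, h1, h2, rfl⟩ := hf
  exact ⟨P, _, _, a, g ∘ₗ b, h1, h2, rfl⟩

theorem mem_projectiveMaps_comp {g : W →ₗ[A] U} (hg : g ∈ projectiveMaps A W U) (f : V →ₗ[A] W) :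
    g ∘ₗ f ∈ projectiveMaps A V U := by
  obtain ⟨P, _, _, a, b, h1, h2, rfl⟩ := hg
  exact ⟨P, _, _, a ∘ₗ f, b, h1, h2, rfl⟩

theorem StableHom.mk_eq_zero {f : V →ₗ[A] W} :
    StableHom.mk f = 0 ↔ f ∈ projectiveMaps A V W :=
  QuotientAddGroup.eq_zero_iff f

theorem StableHom.sum_comp_mk {ι : Type*} (s : Finset ι) {X : ι → Type u} [∀ i, AddCommGroup (X i)]
    [∀ i, Module A (X i)] (g : ∀ i, X i →ₗ[A] U) (f : ∀ i, V →ₗ[A] X i) :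
    ∑ i ∈ s, (StableHom.mk (g i)).comp (StableHom.mk (f i)) = StableHom.mk (∑ i ∈ s, g i ∘ₗ f i) :=
  (map_sum (QuotientAddGroup.mk' (projectiveMaps A V U)) (fun i => g i ∘ₗ f i) s).symm

/-- Modules that are isomorphic up to projective summands are isomorphic in the stable category. -/
theorem StablyEquivalent.exists_stable_inverse (h : StablyEquivalent A V W) :
    ∃ (q : V →ₗ[A] W) (e : W →ₗ[A] V), q ∘ₗ e - LinearMap.id ∈ projectiveMaps A W W ∧
      e ∘ₗ q - LinearMap.id ∈ projectiveMaps A V V := by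
  obtain ⟨F, _, _, F', _, _, ⟨hF₁, hF₂⟩, ⟨hF₁', hF₂'⟩, ⟨E⟩⟩ := h
  refine ⟨LinearMap.fst A W F' ∘ₗ E.toLinearMap ∘ₗ LinearMap.inl A V F,
    LinearMap.fst A V F ∘ₗ E.symm.toLinearMap ∘ₗ LinearMap.inl A W F',
    ⟨F, _, _, LinearMap.snd A V F ∘ₗ E.symm.toLinearMap ∘ₗ LinearMap.inl A W F',
      -(LinearMap.fst A W F' ∘ₗ E.toLinearMap ∘ₗ LinearMap.inr A V F), hF₁, hF₂, ?_⟩,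
    ⟨F', _, _, LinearMap.snd A W F' ∘ₗ E.toLinearMap ∘ₗ LinearMap.inl A V F,
      -(LinearMap.fst A V F ∘ₗ E.symm.toLinearMap ∘ₗ LinearMap.inr A W F'), hF₁', hF₂', ?_⟩⟩
  · refine LinearMap.ext fun w => ?_
    have h : E ((E.symm (w, 0)).1, 0) + E (0, (E.symm (w, 0)).2) = (w, 0) := by
      rw [← map_add]; simp
    have h' : (E ((E.symm (w, 0)).1, 0)).1 + (E (0, (E.symm (w, 0)).2)).1 = w :=
      congrArg Prod.fst h
    change (E ((E.symm (w, 0)).1, 0)).1 - w = -(E (0, (E.symm (w, 0)).2)).1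
    rw [eq_neg_iff_add_eq_zero, sub_add_eq_add_sub, sub_eq_zero]
    exact h'
  · refine LinearMap.ext fun w => ?_
    have h : E.symm ((E (w, 0)).1, 0) + E.symm (0, (E (w, 0)).2) = (w, 0) := by
      rw [← map_add]; simp
    have h' : (E.symm ((E (w, 0)).1, 0)).1 + (E.symm (0, (E (w, 0)).2)).1 = w :=
      congrArg Prod.fst h
    change (E.symm ((E (w, 0)).1, 0)).1 - w = -(E.symm (0, (E (w, 0)).2)).1
    rw [eq_neg_iff_add_eq_zero, sub_add_eq_add_sub, sub_eq_zero]
    exact h'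

/-- A surjection that splits in the stable category splits. -/
theorem exists_section_of_stable_section {φ : V →ₗ[A] W} (hφ : Function.Surjective φ)
    {σ : W →ₗ[A] V} (h : φ ∘ₗ σ - LinearMap.id ∈ projectiveMaps A W W) :
    ∃ τ : W →ₗ[A] V, φ ∘ₗ τ = LinearMap.id := by
  obtain ⟨Q, _, _, a, b, _, _, hab⟩ := h
  obtain ⟨b', hb'⟩ := Module.projective_lifting_property φ b hφ
  refine ⟨σ - b' ∘ₗ a, ?_⟩
  rw [LinearMap.comp_sub, ← LinearMap.comp_assoc, hb', ← hab]
  abel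

end StableMaps

section Rank

variable {K : Type u} [Field K] {p : ℕ}

/-- For `p ≥ 2`, a module `S` with `t S = 0` has no nonzero endomorphism that factors through a
projective module. -/
theorem eq_zero_of_mem_projectiveMaps (hp : 2 ≤ p) {S : Type u} [AddCommGroup S] [Module (Trunc K p) S]
    (hS : ∀ s : S, Trunc.t K p • s = 0) {f : S →ₗ[Trunc K p] S}
    (hf : f ∈ projectiveMaps (Trunc K p) S S) : f = 0 := by
  have : NeZero p := ⟨by omega⟩
  obtain ⟨F, _, _, a, b, _, _, rfl⟩ := hf
  obtain ⟨n, ⟨e⟩⟩ := Trunc.exists_equiv_of_projective (K := K) (p := p) F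
  refine LinearMap.ext fun s => ?_
  -- the image of `s` in the free module is killed by `t`, hence divisible by `t`
  have h : ∀ i, ∃ z, e (a s) i = Trunc.t K p * z := fun i => by
    have h0 : Trunc.t K p ^ 1 * e (a s) i = 0 := by
      rw [pow_one]
      have : Trunc.t K p • e (a s) = 0 := by rw [← map_smul, ← map_smul, hS, map_zero, map_zero]
      exact congrFun this i
    obtain ⟨z, hz⟩ := (Trunc.t_pow_mul_eq_zero (i := p - 1) (by omega) _).mp h0
    refine ⟨Trunc.t K p ^ (p - 2) * z, ?_⟩
    rw [hz, ← mul_assoc, ← pow_succ']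
    congr 2
    omega
  choose z hz using h
  have hz' : a s = Trunc.t K p • e.symm z := by
    rw [← map_smul, LinearEquiv.eq_symm_apply]
    exact funext hz
  rw [LinearMap.comp_apply, hz', map_smul, hS, LinearMap.zero_apply]

theorem Trunc.algebraMap_zero_smul {W : Type*} [AddCommGroup W] [Module (Trunc K p) W] (w : W) :
    algebraMap K (Trunc K p) 0 • w = 0 := by
  rw [map_zero]
  exact zero_smul (Trunc K p) w

theorem Trunc.algebraMap_one_smul {W : Type*} [AddCommGroup W] [Module (Trunc K p) W] (w : W) :
    algebraMap K (Trunc K p) 1 • w = w := by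
  rw [map_one]
  exact one_smul (Trunc K p) w

/-- Let `S` be a one-dimensional module with `t S = 0`. A matrix of homomorphisms between modules
stably equivalent to `S` with independent rows has a stable right inverse. -/
theorem exists_stable_right_inverse (hp : 2 ≤ p) {S : Type u} [AddCommGroup S]
    [Module (Trunc K p) S] (hS : ∀ s : S, Trunc.t K p • s = 0) {v : S} (hv : v ≠ 0)
    (hspan : ∀ s : S, ∃ κ : K, algebraMap K (Trunc K p) κ • v = s)
    {m n : ℕ} {X : Fin m → Type u} {Y : Fin n → Type u}
    [∀ j, AddCommGroup (X j)] [∀ j, Module (Trunc K p) (X j)]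
    [∀ i, AddCommGroup (Y i)] [∀ i, Module (Trunc K p) (Y i)]
    (hX : ∀ j, StablyEquivalent (Trunc K p) (X j) S)
    (hY : ∀ i, StablyEquivalent (Trunc K p) (Y i) S)
    (c : ∀ i j, X j →ₗ[Trunc K p] Y i)
    (hc : ∀ a : ∀ i, Y i →ₗ[Trunc K p] S,
      (∀ j, ∑ i, a i ∘ₗ c i j ∈ projectiveMaps (Trunc K p) (X j) S) →
        ∀ i, a i ∈ projectiveMaps (Trunc K p) (Y i) S) :
    ∃ σ : ∀ j l, Y l →ₗ[Trunc K p] X j,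
      (∀ i, ∑ j, c i j ∘ₗ σ j i - LinearMap.id ∈ projectiveMaps (Trunc K p) (Y i) (Y i)) ∧
      ∀ i l, i ≠ l → ∑ j, c i j ∘ₗ σ j l ∈ projectiveMaps (Trunc K p) (Y l) (Y i) := by
  choose qX eX hqX heX using fun j => (hX j).exists_stable_inverse
  choose qY eY hqY heY using fun i => (hY i).exists_stable_inverse
  have hend : ∀ f : S →ₗ[Trunc K p] S, ∃ κ : K, f = algebraMap K (Trunc K p) κ • LinearMap.id := by
    intro f
    obtain ⟨κ, hκ⟩ := hspan (f v)
    refine ⟨κ, LinearMap.ext fun s => ?_⟩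
    obtain ⟨d, rfl⟩ := hspan s
    rw [map_smul, ← hκ, LinearMap.smul_apply, LinearMap.id_apply, smul_comm]
  -- stably, the matrix `c` is the scalar matrix `C`
  choose C hC using fun i j => hend (qY i ∘ₗ c i j ∘ₗ eX j)
  have hinj : ∀ a : Fin n → K, (∀ j, ∑ i, a i * C i j = 0) → a = 0 := by
    intro a ha
    have h := hc (fun i => algebraMap K (Trunc K p) (a i) • qY i) (fun j => by
      have h1 : (∑ i, (algebraMap K (Trunc K p) (a i) • qY i) ∘ₗ c i j) ∘ₗ (eX j ∘ₗ qX j) = 0 := by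
        refine LinearMap.ext fun x => ?_
        simp only [LinearMap.comp_apply, LinearMap.sum_apply, LinearMap.smul_apply]
        have h2 : ∀ i, qY i (c i j (eX j (qX j x))) = algebraMap K (Trunc K p) (C i j) • qX j x :=
          fun i => LinearMap.congr_fun (hC i j) (qX j x)
        simp only [h2, ← mul_smul, ← map_mul]
        rw [← Finset.sum_smul, ← map_sum, ha j]
        exact Trunc.algebraMap_zero_smul _
      have h2 := neg_mem (comp_mem_projectiveMaps
        (∑ i, (algebraMap K (Trunc K p) (a i) • qY i) ∘ₗ c i j) (heX j))
      rwa [LinearMap.comp_sub, h1, zero_sub, neg_neg, LinearMap.comp_id] at h2)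
    funext i
    have h3 := mem_projectiveMaps_comp (h i) (eY i)
    have h4 := comp_mem_projectiveMaps (algebraMap K (Trunc K p) (a i) • LinearMap.id) (hqY i)
    have h5 := eq_zero_of_mem_projectiveMaps hp hS (sub_mem h3 h4)
    have h6 : algebraMap K (Trunc K p) (a i) • v = 0 := by
      have := LinearMap.congr_fun h5 v
      simpa [smul_sub] using this
    by_contra hne
    refine hv ?_
    have h7 : algebraMap K (Trunc K p) (a i)⁻¹ • algebraMap K (Trunc K p) (a i) • v = v := by
      rw [← mul_smul, ← map_mul, inv_mul_cancel₀ hne, Trunc.algebraMap_one_smul]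
    rw [← h7, h6, smul_zero]
  obtain ⟨g, hg⟩ := (Fintype.linearCombination K C).exists_leftInverse_of_injective (by
    refine LinearMap.ker_eq_bot'.mpr fun a ha => hinj a fun j => ?_
    have := congrFun ha j
    simpa [Fintype.linearCombination_apply] using this)
  obtain ⟨D, hD⟩ : ∃ D : Fin m → Fin n → K, ∀ i l, ∑ j, C i j * D j l =
      (Pi.single i 1 : Fin n → K) l := by
    refine ⟨fun j => g (Pi.single j 1), fun i l => ?_⟩
    have h1 : g (C i) = Pi.single i 1 := by
      have := LinearMap.congr_fun hg (Pi.single i 1)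
      rwa [LinearMap.comp_apply, Fintype.linearCombination_apply_single, one_smul] at this
    have h2 : C i = ∑ j, C i j • Pi.single j (1 : K) := pi_eq_sum_univ' (C i)
    rw [← h1]
    conv_rhs => rw [h2]
    simp
  let σ : ∀ j l, Y l →ₗ[Trunc K p] X j := fun j l =>
    eX j ∘ₗ (algebraMap K (Trunc K p) (D j l) • qY l)
  -- `(eY i qY i) (∑ j, c i j σ j l) = δ i l • (eY i qY l)`
  have key : ∀ i l, (eY i ∘ₗ qY i) ∘ₗ ∑ j, c i j ∘ₗ σ j l =
      algebraMap K (Trunc K p) ((Pi.single i 1 : Fin n → K) l) • (eY i ∘ₗ qY l) := by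
    intro i l
    refine LinearMap.ext fun y => ?_
    simp only [LinearMap.comp_apply, LinearMap.sum_apply, LinearMap.smul_apply, map_sum, σ]
    have h2 : ∀ j s, qY i (c i j (eX j s)) = algebraMap K (Trunc K p) (C i j) • s :=
      fun j s => LinearMap.congr_fun (hC i j) s
    simp only [h2, ← mul_smul, ← map_mul]
    rw [← map_sum, ← Finset.sum_smul, ← map_sum, hD, map_smul]
  have hmod : ∀ i l, ∑ j, c i j ∘ₗ σ j l - (eY i ∘ₗ qY i) ∘ₗ ∑ j, c i j ∘ₗ σ j l ∈
      projectiveMaps (Trunc K p) (Y l) (Y i) := fun i l => by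
    have := neg_mem (mem_projectiveMaps_comp (heY i) (∑ j, c i j ∘ₗ σ j l))
    rwa [LinearMap.sub_comp, LinearMap.id_comp, neg_sub] at this
  refine ⟨σ, fun i => ?_, fun i l hil => ?_⟩
  · have h1 := hmod i i
    rw [key, Pi.single_eq_same, LinearMap.ext fun y => (LinearMap.smul_apply _ _ y).trans
      (Trunc.algebraMap_one_smul _)] at h1
    have := add_mem h1 (heY i)
    rwa [sub_add_sub_cancel] at this
  · have h1 := hmod i l
    rwa [key, Pi.single_eq_of_ne hil.symm, LinearMap.ext (g := 0) fun y =>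
      (LinearMap.smul_apply _ _ y).trans (Trunc.algebraMap_zero_smul _), sub_zero] at h1

end Rank

/-! ### Heller shifts and the kernel of `φ` -/

section HellerShift

variable {k R : Type u} [Field k] [CommRing R] [HopfAlgebra k R] [Module.Finite k R]
  {K : Type u} [Field K] [Algebra k K] {p : ℕ}
  {α : Trunc K p →ₐ[K] K ⊗[k] GroupAlgebra k R}

instance : Module.Finite (GroupAlgebra k R) (Trivial k R) :=
  Module.Finite.of_restrictScalars_finite k _ _

theorem finite_of_isIterSyzygy (n : ℕ) : ∀ (V : Type u) [AddCommGroup V]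
    [Module (GroupAlgebra k R) V], IsIterSyzygy (GroupAlgebra k R) (Trivial k R) n V →
      Module.Finite (GroupAlgebra k R) V := by
  cases n with
  | zero =>
    rintro V _ _ ⟨e⟩
    exact Module.Finite.equiv e.symm
  | succ n =>
    rintro V _ _ ⟨U, _, _, -, P, _, _, f, _, -, -, -, ⟨e⟩⟩
    exact Module.Finite.equiv e.symm

omit [Module.Finite k R] in
theorem finite_of_isIterCosyzygy (n : ℕ) : ∀ (V : Type u) [AddCommGroup V]
    [Module (GroupAlgebra k R) V], IsIterCosyzygy (GroupAlgebra k R) (Trivial k R) n V →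
      Module.Finite (GroupAlgebra k R) V := by
  cases n with
  | zero =>
    rintro V _ _ ⟨e⟩
    exact Module.Finite.equiv e.symm
  | succ n =>
    rintro V _ _ ⟨U, _, _, -, I, _, _, f, _, -, -, -, ⟨e⟩⟩
    exact Module.Finite.equiv e.symm

theorem finite_of_isHellerShift {s : ℤ} {V : Type u} [AddCommGroup V]
    [Module (GroupAlgebra k R) V] (h : IsHellerShift (GroupAlgebra k R) (Trivial k R) s V) :
    Module.Finite (GroupAlgebra k R) V := by
  cases s with
  | ofNat n => exact finite_of_isIterSyzygy n V h
  | negSucc n => exact finite_of_isIterCosyzygy (n + 1) V h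

/-- Up to projective summands, the `n`-th syzygy of `k` restricts to `[1]` for even `n` and to
`[p-1]` for odd `n`. -/
theorem IsPiPoint.stablyEquivalent_of_isIterSyzygy (hp : 2 ≤ p) (hα : IsPiPoint α) (n : ℕ) :
    ∀ (V : Type u) [AddCommGroup V] [Module k V] [Module (GroupAlgebra k R) V]
      [IsScalarTower k (GroupAlgebra k R) V],
      IsIterSyzygy (GroupAlgebra k R) (Trivial k R) n V →
      (Even n → StablyEquivalent (Trunc K p) (Restrict α V) (JordanBlock K p 1)) ∧
      (Odd n → StablyEquivalent (Trunc K p) (Restrict α V) (JordanBlock K p (p - 1))) := by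
  have : NeZero p := ⟨by omega⟩
  have h1 : 1 + (p - 1) = p := by omega
  have h2 : (p - 1) + 1 = p := by omega
  induction n with
  | zero =>
    rintro V _ _ _ _ ⟨e⟩
    obtain ⟨e'⟩ := nonempty_restrict_trivial_equiv (α := α)
    exact ⟨fun _ => .of_equiv ((restrictEquiv α e).trans e'), fun h => by simp at h⟩
  | succ n ih =>
    rintro V _ _ _ _ ⟨U, _, _, hU, P, _, _, f, _, _, hf, -, ⟨e⟩⟩
    let _ : Module k U := baseModule (k := k) (R := R) U
    have : IsScalarTower k (GroupAlgebra k R) U := baseModule_isScalarTower U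
    let _ : Module k P := baseModule (k := k) (R := R) P
    have : IsScalarTower k (GroupAlgebra k R) P := baseModule_isScalarTower P
    have := hα.projective_restrict (V := P)
    have := finite_restrict (α := α) (V := P)
    let g : V →ₗ[GroupAlgebra k R] P := (LinearMap.ker f).subtype ∘ₗ e.toLinearMap
    have hg : Function.Injective g := Subtype.val_injective.comp e.injective
    have hgf : Function.Exact g f := fun x =>
      ⟨fun hx => ⟨e.symm ⟨x, hx⟩, by simp [g]⟩, by rintro ⟨y, rfl⟩; exact (e y).2⟩
    obtain ⟨ih₀, ih₁⟩ := ih U hU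
    refine ⟨fun hn => ?_, fun hn => ?_⟩
    · exact StablyEquivalent.kernel (restrictHom_injective α hg) (restrictHom_exact α hgf)
        (restrictHom_surjective α hf) (JordanBlock.incl_injective h1) (JordanBlock.exact h1)
        (JordanBlock.proj_surjective _) (ih₁ (by grind))
    · exact StablyEquivalent.kernel (restrictHom_injective α hg) (restrictHom_exact α hgf)
        (restrictHom_surjective α hf) (JordanBlock.incl_injective h2) (JordanBlock.exact h2)
        (JordanBlock.proj_surjective _) (ih₀ (by grind))

/-- Up to projective summands, the `n`-th cosyzygy of `k` restricts to `[1]` for even `n` and to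
`[p-1]` for odd `n`. -/
theorem IsPiPoint.stablyEquivalent_of_isIterCosyzygy (hp : 2 ≤ p) (hα : IsPiPoint α) (n : ℕ) :
    ∀ (V : Type u) [AddCommGroup V] [Module k V] [Module (GroupAlgebra k R) V]
      [IsScalarTower k (GroupAlgebra k R) V],
      IsIterCosyzygy (GroupAlgebra k R) (Trivial k R) n V →
      (Even n → StablyEquivalent (Trunc K p) (Restrict α V) (JordanBlock K p 1)) ∧
      (Odd n → StablyEquivalent (Trunc K p) (Restrict α V) (JordanBlock K p (p - 1))) := by
  have : NeZero p := ⟨by omega⟩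
  have h1 : 1 + (p - 1) = p := by omega
  have h2 : (p - 1) + 1 = p := by omega
  induction n with
  | zero =>
    rintro V _ _ _ _ ⟨e⟩
    obtain ⟨e'⟩ := nonempty_restrict_trivial_equiv (α := α)
    exact ⟨fun _ => .of_equiv ((restrictEquiv α e).trans e'), fun h => by simp at h⟩
  | succ n ih =>
    rintro V _ _ _ _ ⟨U, _, _, hU, I, _, _, f, _, _, hf, -, ⟨e⟩⟩
    have := projective_of_injective (k := k) (R := R) I
    let _ : Module k U := baseModule (k := k) (R := R) U
    have : IsScalarTower k (GroupAlgebra k R) U := baseModule_isScalarTower U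
    let _ : Module k I := baseModule (k := k) (R := R) I
    have : IsScalarTower k (GroupAlgebra k R) I := baseModule_isScalarTower I
    have := hα.projective_restrict (V := I)
    have := finite_restrict (α := α) (V := I)
    let g : I →ₗ[GroupAlgebra k R] V := e.symm.toLinearMap ∘ₗ (LinearMap.range f).mkQ
    have hg : Function.Surjective g := e.symm.surjective.comp (Submodule.mkQ_surjective _)
    have hfg : Function.Exact f g := fun x => by simp [g]
    obtain ⟨ih₀, ih₁⟩ := ih U hU
    refine ⟨fun hn => ?_, fun hn => ?_⟩
    · exact StablyEquivalent.cokernel Trunc.injective_of_projective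
        (restrictHom_injective α hf) (restrictHom_exact α hfg)
        (restrictHom_surjective α hg) (JordanBlock.incl_injective h2) (JordanBlock.exact h2)
        (JordanBlock.proj_surjective _) (ih₁ (by grind))
    · exact StablyEquivalent.cokernel Trunc.injective_of_projective
        (restrictHom_injective α hf) (restrictHom_exact α hfg)
        (restrictHom_surjective α hg) (JordanBlock.incl_injective h1) (JordanBlock.exact h1)
        (JordanBlock.proj_surjective _) (ih₀ (by grind))

/-- Up to projective summands, `Ω^s(k)` restricts to `[1]` if `s` is even or `p = 2`. -/
theorem IsPiPoint.stablyEquivalent_of_isHellerShift (hp : 2 ≤ p) (hα : IsPiPoint α) {s : ℤ}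
    (hs : 2 < p → Even s) {V : Type u} [AddCommGroup V] [Module k V] [Module (GroupAlgebra k R) V]
    [IsScalarTower k (GroupAlgebra k R) V]
    (h : IsHellerShift (GroupAlgebra k R) (Trivial k R) s V) :
    StablyEquivalent (Trunc K p) (Restrict α V) (JordanBlock K p 1) := by
  obtain ⟨n, hn, h0, h1⟩ : ∃ n : ℕ, (Even s → Even n) ∧
      (Even n → StablyEquivalent (Trunc K p) (Restrict α V) (JordanBlock K p 1)) ∧
      (Odd n → StablyEquivalent (Trunc K p) (Restrict α V) (JordanBlock K p (p - 1))) := by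
    cases s with
    | ofNat n =>
      exact ⟨n, fun h => by simpa using h, hα.stablyEquivalent_of_isIterSyzygy hp n V h⟩
    | negSucc n =>
      refine ⟨n + 1, fun h => ?_, hα.stablyEquivalent_of_isIterCosyzygy hp (n + 1) V h⟩
      rw [Int.negSucc_eq, even_neg] at h
      exact_mod_cast h
  rcases Nat.even_or_odd n with he | ho
  · exact h0 he
  · have hp2 : p = 2 := by
      by_contra hne
      exact Nat.not_even_iff_odd.mpr ho (hn (hs (by omega)))
    -- for `p = 2` the blocks `[1]` and `[p-1]` agree
    subst hp2
    exact h1 ho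

end HellerShift

section Splitting

variable {A : Type u} [Ring A] {m n : ℕ} {X : Fin m → Type u} {Y : Fin n → Type u}
  [∀ j, AddCommGroup (X j)] [∀ j, Module A (X j)] [∀ i, AddCommGroup (Y i)] [∀ i, Module A (Y i)]
  {M N : Type u} [AddCommGroup M] [Module A M] [AddCommGroup N] [Module A N]

/-- If `N` is the direct sum of the `Y i`, with projections `pr i` and inclusions `jn i`, then a
stable right inverse of the matrix of a homomorphism `φ : M → N` gives a stable section of `φ`. -/
theorem comp_sum_sub_id_mem_projectiveMaps (φ : M →ₗ[A] N) (inc : ∀ j, X j →ₗ[A] M)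
    (pr : ∀ i, N →ₗ[A] Y i) (jn : ∀ i, Y i →ₗ[A] N) (hjn : ∀ x, ∑ i, jn i (pr i x) = x)
    (c : ∀ i j, X j →ₗ[A] Y i) (hc : ∀ i j x, pr i (φ (inc j x)) = c i j x)
    (σ : ∀ j l, Y l →ₗ[A] X j)
    (hσ : ∀ i, ∑ j, c i j ∘ₗ σ j i - LinearMap.id ∈ projectiveMaps A (Y i) (Y i))
    (hσ' : ∀ i l, i ≠ l → ∑ j, c i j ∘ₗ σ j l ∈ projectiveMaps A (Y l) (Y i)) :
    φ ∘ₗ (∑ l, (∑ j, inc j ∘ₗ σ j l) ∘ₗ pr l) - LinearMap.id ∈ projectiveMaps A N N := by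
  have hT : ∀ l, φ ∘ₗ (∑ j, inc j ∘ₗ σ j l) = ∑ i, jn i ∘ₗ ∑ j, c i j ∘ₗ σ j l := fun l => by
    refine LinearMap.ext fun y => ?_
    simp only [LinearMap.comp_apply, LinearMap.sum_apply]
    rw [← hjn (φ _)]
    simp only [map_sum, hc]
  have hl : ∀ l, φ ∘ₗ (∑ j, inc j ∘ₗ σ j l) - jn l ∈ projectiveMaps A (Y l) N := fun l => by
    rw [hT, ← Finset.add_sum_erase _ _ (Finset.mem_univ l), add_sub_right_comm]
    refine add_mem ?_ (sum_mem fun i hi =>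
      comp_mem_projectiveMaps _ (hσ' i l (Finset.ne_of_mem_erase hi)))
    have := comp_mem_projectiveMaps (jn l) (hσ l)
    rwa [LinearMap.comp_sub, LinearMap.comp_id] at this
  have := sum_mem (t := Finset.univ) fun l _ => mem_projectiveMaps_comp (hl l) (pr l)
  refine (congrArg (· ∈ projectiveMaps A N N) (LinearMap.ext fun x => ?_)).mp this
  simp only [LinearMap.sub_apply, LinearMap.comp_apply, LinearMap.sum_apply, LinearMap.id_apply,
    Finset.sum_sub_distrib, hjn, map_sum]

end Splitting

/-- Rearrangement of the summands in a split sequence `0 → L → X ⊕ P → Y → 0` in which `X` and `Y`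
are isomorphic to `S` and `S'` up to the summands `F`, `F'`, `G`, `G'`. -/
def splitRearrange {A : Type*} [Ring A] {L X Y P F F' G G' S S' : Type*}
    [AddCommGroup L] [Module A L] [AddCommGroup X] [Module A X] [AddCommGroup Y] [Module A Y]
    [AddCommGroup P] [Module A P] [AddCommGroup F] [Module A F] [AddCommGroup F'] [Module A F']
    [AddCommGroup G] [Module A G] [AddCommGroup G'] [Module A G'] [AddCommGroup S] [Module A S]
    [AddCommGroup S'] [Module A S'] (e : (L × Y) ≃ₗ[A] X × P) (e₁ : (X × F) ≃ₗ[A] S × F')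
    (e₂ : (Y × G) ≃ₗ[A] S' × G') : (L × S' × G' × F) ≃ₗ[A] S × F' × P × G :=
  (LinearEquiv.prodCongr (LinearEquiv.refl A L) ((LinearEquiv.prodAssoc A S' G' F).symm.trans
    (LinearEquiv.prodCongr e₂.symm (LinearEquiv.refl A F)))).trans <|
  (LinearEquiv.prodAssoc A L (Y × G) F).symm.trans <|
  (LinearEquiv.prodCongr ((LinearEquiv.prodAssoc A L Y G).symm.trans
    ((LinearEquiv.prodCongr e (LinearEquiv.refl A G)).trans (LinearEquiv.prodAssoc A X P G)))
    (LinearEquiv.refl A F)).trans <|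
  (LinearEquiv.prodAssoc A X (P × G) F).trans <|
  (LinearEquiv.prodCongr (LinearEquiv.refl A X) (LinearEquiv.prodComm A (P × G) F)).trans <|
  (LinearEquiv.prodAssoc A X F (P × G)).symm.trans <|
  (LinearEquiv.prodCongr e₁ (LinearEquiv.refl A (P × G))).trans <|
  LinearEquiv.prodAssoc A S F' (P × G)

section Kernel

variable {k R : Type u} [Field k] [CommRing R] [HopfAlgebra k R] [Module.Finite k R]
  {K : Type u} [Field K] [Algebra k K] {p : ℕ}
  {α : Trunc K p →ₐ[K] K ⊗[k] GroupAlgebra k R}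
  {m n : ℕ}
  {X : Fin m → Type u} [∀ j, AddCommGroup (X j)] [∀ j, Module k (X j)]
  [∀ j, Module (GroupAlgebra k R) (X j)] [∀ j, IsScalarTower k (GroupAlgebra k R) (X j)]
  {Y : Fin n → Type u} [∀ i, AddCommGroup (Y i)] [∀ i, Module k (Y i)]
  [∀ i, Module (GroupAlgebra k R) (Y i)] [∀ i, IsScalarTower k (GroupAlgebra k R) (Y i)]
  {P L M N : Type u} [AddCommGroup P] [Module k P] [Module (GroupAlgebra k R) P]
  [IsScalarTower k (GroupAlgebra k R) P]
  [AddCommGroup L] [Module k L] [Module (GroupAlgebra k R) L] [IsScalarTower k (GroupAlgebra k R) L]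
  [AddCommGroup M] [Module k M] [Module (GroupAlgebra k R) M] [IsScalarTower k (GroupAlgebra k R) M]
  [AddCommGroup N] [Module k N] [Module (GroupAlgebra k R) N] [IsScalarTower k (GroupAlgebra k R) N]

omit [Module.Finite k R] [Module k P] [IsScalarTower k (GroupAlgebra k R) P] in
/-- If the restricted matrix of `φ` has full row rank, then the restriction of `φ` splits. -/
theorem exists_section_restrictHom (hp : 2 ≤ p)
    (hX : ∀ j, StablyEquivalent (Trunc K p) (Restrict α (X j)) (JordanBlock K p 1))
    (hY : ∀ i, StablyEquivalent (Trunc K p) (Restrict α (Y i)) (JordanBlock K p 1))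
    (ζ : ∀ i j, X j →ₗ[GroupAlgebra k R] Y i) (φ : M →ₗ[GroupAlgebra k R] N)
    (hφ : Function.Surjective φ)
    (eM : M ≃ₗ[GroupAlgebra k R] (∀ j, X j) × P) (eN : N ≃ₗ[GroupAlgebra k R] ∀ i, Y i)
    (hζ : ∀ (x : ∀ j, X j) (i : Fin n), eN (φ (eM.symm (x, 0))) i = ∑ j, ζ i j (x j))
    (hrank : HasFullRowRank K p (fun i j => StableHom.mk (restrictHom α (ζ i j)))) :
    ∃ τ : Restrict α N →ₗ[Trunc K p] Restrict α M, restrictHom α φ ∘ₗ τ = LinearMap.id := by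
  have : NeZero p := ⟨by omega⟩
  obtain ⟨v, hv, hspan⟩ := finrank_eq_one_iff'.mp (JordanBlock.finrank_one (K := K) (p := p))
  -- the rank hypothesis is used in degree `d = 0`, where `Ω^d(K) = [1]`
  obtain ⟨σ, hσ, hσ'⟩ := exists_stable_right_inverse hp JordanBlock.t_smul_one hv
    (fun s => (hspan s).imp fun κ hκ => by rw [algebraMap_smul, hκ]) hX hY
    (fun i j => restrictHom α (ζ i j)) (fun a ha i => by
      refine StableHom.mk_eq_zero.mp
        (hrank 0 (JordanBlock K p 1) ⟨LinearEquiv.refl _ _⟩ (fun i => StableHom.mk (a i)) ?_ i)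
      intro j
      exact (StableHom.sum_comp_mk _ _ _).trans (StableHom.mk_eq_zero.mpr (ha j)))
  let inc : ∀ j, X j →ₗ[GroupAlgebra k R] M := fun j =>
    eM.symm.toLinearMap ∘ₗ LinearMap.inl _ _ _ ∘ₗ LinearMap.single _ X j
  let pr : ∀ i, N →ₗ[GroupAlgebra k R] Y i := fun i => LinearMap.proj i ∘ₗ eN.toLinearMap
  let jn : ∀ i, Y i →ₗ[GroupAlgebra k R] N := fun i => eN.symm.toLinearMap ∘ₗ LinearMap.single _ Y i
  have hpr : ∀ i j, pr i ∘ₗ φ ∘ₗ inc j = ζ i j := fun i j => by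
    refine LinearMap.ext fun x => (hζ (Pi.single j x) i).trans ?_
    rw [Finset.sum_eq_single j, Pi.single_eq_same]
    · intro j' _ hj'
      rw [Pi.single_eq_of_ne hj', map_zero]
    · exact fun h => absurd (Finset.mem_univ j) h
  have hjn : ∑ i, jn i ∘ₗ pr i = LinearMap.id := LinearMap.ext fun x => by
    rw [LinearMap.sum_apply]
    change ∑ i, eN.symm (Pi.single i (eN x i)) = x
    rw [← map_sum, Finset.univ_sum_single, LinearEquiv.symm_apply_apply]
  have hjn' : ∑ i, restrictHom α (jn i) ∘ₗ restrictHom α (pr i) = LinearMap.id := by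
    rw [← restrictHom_id, ← hjn, restrictHom_sum]
    exact Finset.sum_congr rfl fun i _ => (restrictHom_comp α _ _).symm
  have hpr' : ∀ i j x, restrictHom α (pr i) (restrictHom α φ (restrictHom α (inc j) x)) =
      restrictHom α (ζ i j) x := fun i j x => by
    rw [← hpr, restrictHom_comp α (pr i), restrictHom_comp α φ]
    rfl
  have hid : ∀ x, ∑ i, restrictHom α (jn i) (restrictHom α (pr i) x) = x := fun x => by
    have := LinearMap.congr_fun hjn' x
    rwa [LinearMap.sum_apply] at this
  exact exists_section_of_stable_section (restrictHom_surjective α hφ)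
    (comp_sum_sub_id_mem_projectiveMaps (restrictHom α φ) (fun j => restrictHom α (inc j))
      (fun i => restrictHom α (pr i)) (fun i => restrictHom α (jn i)) hid _ hpr' σ hσ hσ')

/-- The restriction of the kernel of `φ` is `(m - n)[1]` plus a free module. -/
theorem nonempty_restrict_equiv_of_section (hp : 2 ≤ p) (hα : IsPiPoint α)
    [Module.Finite k L] [Module.Finite (GroupAlgebra k R) P]
    [Module.Projective (GroupAlgebra k R) P]
    (hX : ∀ j, StablyEquivalent (Trunc K p) (Restrict α (X j)) (JordanBlock K p 1))
    (hY : ∀ i, StablyEquivalent (Trunc K p) (Restrict α (Y i)) (JordanBlock K p 1))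
    {ι : L →ₗ[GroupAlgebra k R] M} {φ : M →ₗ[GroupAlgebra k R] N}
    (hι : Function.Injective ι) (hex : Function.Exact ι φ)
    (eM : M ≃ₗ[GroupAlgebra k R] (∀ j, X j) × P) (eN : N ≃ₗ[GroupAlgebra k R] ∀ i, Y i)
    {τ : Restrict α N →ₗ[Trunc K p] Restrict α M} (hτ : restrictHom α φ ∘ₗ τ = LinearMap.id) :
    ∃ b : ℕ, Nonempty (Restrict α L ≃ₗ[Trunc K p]
      (Fin (m - n) → JordanBlock K p 1) × (Fin b → Trunc K p)) := by
  have : NeZero p := ⟨by omega⟩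
  obtain ⟨F, _, _, F', _, _, ⟨_, _⟩, ⟨_, _⟩, ⟨e₁⟩⟩ := StablyEquivalent.pi hX
  obtain ⟨G, _, _, G', _, _, ⟨_, _⟩, ⟨_, _⟩, ⟨e₂⟩⟩ := StablyEquivalent.pi hY
  have := hα.projective_restrict (V := P)
  have := finite_restrict (α := α) (V := P)
  have split : Restrict α M ≃ₗ[Trunc K p] Restrict α L × Restrict α N :=
    ((restrictHom_exact α hex).splitSurjectiveEquiv (restrictHom_injective α hι) ⟨τ, hτ⟩).1
  have fM : Restrict α M ≃ₗ[Trunc K p] (∀ j, Restrict α (X j)) × Restrict α P :=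
    ((restrictEquiv α eM).trans (restrictProd α _ _)).trans
      (LinearEquiv.prodCongr (restrictPi α X) (LinearEquiv.refl _ _))
  have fN : Restrict α N ≃ₗ[Trunc K p] ∀ i, Restrict α (Y i) :=
    (restrictEquiv α eN).trans (restrictPi α Y)
  obtain ⟨f, ⟨e₃⟩⟩ := Trunc.exists_equiv_of_projective (K := K) (p := p) (G' × F)
  obtain ⟨f', ⟨e₄⟩⟩ := Trunc.exists_equiv_of_projective (K := K) (p := p)
    (F' × (Restrict α P × G))
  have e := splitRearrange
    (((LinearEquiv.prodCongr (LinearEquiv.refl _ (Restrict α L)) fN).symm.trans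
      split.symm).trans fM) e₁ e₂
  exact exists_equiv_of_prod_equiv (n := n) (f := f) (f' := f') hp (Restrict α L)
    (((LinearEquiv.prodCongr (LinearEquiv.refl _ (Restrict α L))
      (LinearEquiv.prodCongr (LinearEquiv.refl _ _) e₃)).symm.trans e).trans
        (LinearEquiv.prodCongr (LinearEquiv.refl _ _) e₄))

end Kernel
end FinGroupScheme

theorem theorem6p5 {k R : Type u} [Field k] [CommRing R] [HopfAlgebra k R] [Module.Finite k R]
    {p : ℕ} [Fact p.Prime] [CharP k p]
    {m n : ℕ} (hmn : n < m) (r : Fin m → ℤ) (s : Fin n → ℤ)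
    (heven : 2 < p → (∀ j, Even (r j)) ∧ ∀ i, Even (s i))
    -- the Heller shifts `X j` of degree `r j` and `Y i` of degree `s i`
    {X : Fin m → Type u} [∀ j, AddCommGroup (X j)] [∀ j, Module k (X j)]
    [∀ j, Module (GroupAlgebra k R) (X j)] [∀ j, IsScalarTower k (GroupAlgebra k R) (X j)]
    (hX : ∀ j, IsHellerShift (GroupAlgebra k R) (Trivial k R) (r j) (X j))
    {Y : Fin n → Type u} [∀ i, AddCommGroup (Y i)] [∀ i, Module k (Y i)]
    [∀ i, Module (GroupAlgebra k R) (Y i)] [∀ i, IsScalarTower k (GroupAlgebra k R) (Y i)]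
    (hY : ∀ i, IsHellerShift (GroupAlgebra k R) (Trivial k R) (s i) (Y i))
    -- homomorphisms representing the Tate cohomology classes
    (ζ : ∀ i j, X j →ₗ[GroupAlgebra k R] Y i)
    -- the projective summand `P` of `M`
    {P : Type u} [AddCommGroup P] [Module (GroupAlgebra k R) P]
    [Module.Finite (GroupAlgebra k R) P] [Module.Projective (GroupAlgebra k R) P]
    -- the exact sequence `0 → L → M → N → 0`
    {L M N : Type u} [AddCommGroup L] [Module k L] [Module (GroupAlgebra k R) L]
    [IsScalarTower k (GroupAlgebra k R) L]
    [AddCommGroup M] [Module (GroupAlgebra k R) M]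
    [AddCommGroup N] [Module (GroupAlgebra k R) N]
    (ι : L →ₗ[GroupAlgebra k R] M) (φ : M →ₗ[GroupAlgebra k R] N)
    (hι : Function.Injective ι) (hex : Function.Exact ι φ) (hφ : Function.Surjective φ)
    (eM : M ≃ₗ[GroupAlgebra k R] (∀ j, X j) × P) (eN : N ≃ₗ[GroupAlgebra k R] ∀ i, Y i)
    -- `φ` is given by the matrix `ζ` on the sum of the Heller shifts
    (hζ : ∀ (x : ∀ j, X j) (i : Fin n), eN (φ (eM.symm (x, 0))) i = ∑ j, ζ i j (x j))
    (hrank : ∀ (K : Type u) [Field K] [Algebra k K]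
      (α : Trunc K p →ₐ[K] K ⊗[k] GroupAlgebra k R), IsPiPoint α →
      HasFullRowRank K p (fun i j => StableHom.mk (restrictHom α (ζ i j)))) :
    HasStableConstantJordanType k R p (Pi.single 1 (m - n)) L := by
  have hp : 2 ≤ p := (Fact.out : p.Prime).two_le
  let _ : Module k P := baseModule (k := k) (R := R) P
  have : IsScalarTower k (GroupAlgebra k R) P := baseModule_isScalarTower P
  let _ : Module k M := baseModule (k := k) (R := R) M
  have : IsScalarTower k (GroupAlgebra k R) M := baseModule_isScalarTower M
  let _ : Module k N := baseModule (k := k) (R := R) N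
  have : IsScalarTower k (GroupAlgebra k R) N := baseModule_isScalarTower N
  have hL : Module.Finite k L := by
    have := fun j => finite_of_isHellerShift (hX j)
    have : Module.Finite (GroupAlgebra k R) M := Module.Finite.equiv eM.symm
    have : Module.Finite (GroupAlgebra k R) L := Module.Finite.of_injective ι hι
    exact Module.Finite.trans (GroupAlgebra k R) L
  -- the number of free summands is forced by the dimension of `L`
  obtain ⟨a, ha⟩ : ∃ a : ℕ → ℕ, a = Function.update (Pi.single 1 (m - n)) p
    ((Module.finrank k L - (m - n)) / p) := ⟨_, rfl⟩
  have ha1 : a 1 = m - n := by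
    rw [ha, Function.update_of_ne (by omega), Pi.single_eq_same]
  have hap : a p = (Module.finrank k L - (m - n)) / p := by
    rw [ha, Function.update_self]
  have hai : ∀ i, i ≠ p → a i = (Pi.single 1 (m - n) : ℕ → ℕ) i := fun i hi => by
    rw [ha, Function.update_of_ne hi]
  refine ⟨a, fun i _ hi => hai i hi.ne, hL, fun K _ _ α hα => ?_⟩
  have : NeZero p := ⟨by omega⟩
  have hX' := fun j => hα.stablyEquivalent_of_isHellerShift hp (fun h => (heven h).1 j) (hX j)
  have hY' := fun i => hα.stablyEquivalent_of_isHellerShift hp (fun h => (heven h).2 i) (hY i)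
  obtain ⟨τ, hτ⟩ := exists_section_restrictHom hp hX' hY' ζ φ hφ eM eN hζ (hrank K α hα)
  obtain ⟨b, ⟨e⟩⟩ := nonempty_restrict_equiv_of_section hp hα hX' hY' hι hex eM eN hτ
  have hb : b = a p := by
    have := finrank_eq_of_equiv JordanBlock.finrank_one e
    rw [Restrict.finrank] at this
    rw [hap, this, Nat.add_sub_cancel_left, Nat.mul_div_cancel _ (by omega)]
  rw [← ha1, hb] at e
  exact hasJordanType_of_equiv hp _ a
    (fun i hi hip => by rw [hai i hip, Pi.single_eq_of_ne hi]) e
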